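/- Let $\mathbb{H}$ be the quaternions and let $V$ be a finitely generated left $\mathbb{H}$-module with its standard topology (that of $\mathbb{H}^n\cong\mathbb{R}^{4n}$). A hyperplane in $V$ is the kernel of a non-zero $\mathbb{H}$-linear map $V\to\mathbb{H}$. Let $\mathcal{A}$ be a finite set of hyperplanes in $V$, and let $X=V\setminus\bigcup_{B\in\mathcal{A}}B$ be its complement. Write $H^i$ for singular cohomology with integer coefficients, with $H^i=0$ for $i<0$. (1) For $A\in\mathcal{A}$, let $X'\supseteq X$ be the complement in $V$ of the deletion $\mathcal{A}'=\mathcal{A}\setminus\{A\}$, and let $X''$ be the complement in $A$ of the restriction $\mathcal{A}''=\{B\cap A\mid B\in\mathcal{A}'\}$, a finite set of hyperplanes in the $\mathbb{H}$-module $A$. Then for every $A\in\mathcal{A}$ and every $i\in\mathbb{Z}$ there is a short exact sequence of abelian groups $$0\to H^i(X')\to H^i(X)\xrightarrow{\ \sigma\ }H^{i-3}(X'')\to 0,$$ in which the first map is induced by the inclusion $X\subseteq X'$. (2) If $i\in\mathbb{Z}$ is not a multiple of $3$, or $i<0$, or $i>3\dim_{\mathbb{H}}V$, then $H^i(X)=0$.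 -/

import Mathlib

open scoped Quaternion

universe u

noncomputable section

namespace QuaternionicArrangement

open CategoryTheory Opposite

/-- The integral singular cohomology `Hⁿ(-; ℤ)`, for `n : ℕ`, as a contravariant functor: the
`n`-th cohomology of the cochain complex `Hom(C_•(-; ℤ), ℤ)`, where `C_•(-; ℤ)` is the singular
chain complex. -/
def singularCohomologyNat (n : ℕ) : TopCat.{u}ᵒᵖ ⥤ AddCommGrpCat.{u} :=
  ((AlgebraicTopology.singularChainComplexFunctor AddCommGrpCat.{u}).obj
      (AddCommGrpCat.of (ULift.{u} ℤ))).op ⋙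
    HomologicalComplex.opFunctor AddCommGrpCat.{u} (ComplexShape.down ℕ) ⋙
    (preadditiveYoneda.obj (AddCommGrpCat.of (ULift.{u} ℤ))).mapHomologicalComplex
      (ComplexShape.down ℕ).symm ⋙
    HomologicalComplex.homologyFunctor AddCommGrpCat.{u} (ComplexShape.down ℕ).symm n

/-- Integral singular cohomology in all integral degrees; it is zero in negative degrees. -/
def singularCohomology : ℤ → (TopCat.{u}ᵒᵖ ⥤ AddCommGrpCat.{u})
  | Int.ofNat n => singularCohomologyNat n
  | Int.negSucc _ => (Functor.const _).obj (AddCommGrpCat.of PUnit)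

variable {V : Type u} [AddCommGroup V] [Module ℍ[ℝ] V]

/-- A (central) hyperplane: the kernel of a non-zero `ℍ`-linear map `V → ℍ`. -/
def IsHyperplane (A : Submodule ℍ[ℝ] V) : Prop :=
  ∃ a : V →ₗ[ℍ[ℝ]] ℍ[ℝ], a ≠ 0 ∧ LinearMap.ker a = A

theorem IsHyperplane.eq_of_le {A B : Submodule ℍ[ℝ] V} (hA : IsHyperplane A)
    (hB : IsHyperplane B) (h : A ≤ B) : A = B := by
  obtain ⟨a, ha, rfl⟩ := hA
  obtain ⟨b, hb, rfl⟩ := hB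
  refine le_antisymm h fun v hv => ?_
  by_contra hav
  rw [LinearMap.mem_ker] at hv hav
  refine hb (LinearMap.ext fun w => ?_)
  have hw : w - (a w * (a v)⁻¹) • v ∈ LinearMap.ker a := by
    rw [LinearMap.mem_ker, map_sub, map_smul, smul_eq_mul, mul_assoc, inv_mul_cancel₀ hav,
      mul_one, sub_self]
  have := h hw
  rwa [LinearMap.mem_ker, map_sub, map_smul, hv, smul_zero, sub_zero] at this

variable (V) in
/-- A hyperplane arrangement in `V`: a finite set of hyperplanes. -/
structure Arrangement where
  hyperplanes : Set (Submodule ℍ[ℝ] V)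
  finite : hyperplanes.Finite
  isHyperplane : ∀ A ∈ hyperplanes, IsHyperplane A

namespace Arrangement

/-- The complement `V ∖ ⋃ A`, the union being over the hyperplanes of the arrangement. -/
def complement (𝒜 : Arrangement V) : Set V :=
  (⋃ A ∈ 𝒜.hyperplanes, (A : Set V))ᶜ

/-- The deletion `𝒜' = 𝒜 ∖ {A}`. -/
def deletion (𝒜 : Arrangement V) (A : Submodule ℍ[ℝ] V) : Arrangement V where
  hyperplanes := 𝒜.hyperplanes \ {A}
  finite := 𝒜.finite.subset Set.sdiff_subset
  isHyperplane B hB := 𝒜.isHyperplane B hB.1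

/-- The restriction `𝒜'' = {B ∩ A | B ∈ 𝒜'}`, an arrangement in the module `A`. -/
def restriction (𝒜 : Arrangement V) (A : Submodule ℍ[ℝ] V) (hA : A ∈ 𝒜.hyperplanes) :
    Arrangement A where
  hyperplanes := (fun B => B.comap A.subtype) '' (𝒜.deletion A).hyperplanes
  finite := (𝒜.deletion A).finite.image _
  isHyperplane := by
    rintro _ ⟨B, ⟨hB, hne⟩, rfl⟩
    obtain ⟨b, hb, hbB⟩ := 𝒜.isHyperplane B hB
    refine ⟨b.comp A.subtype, fun h0 => hne ?_, ?_⟩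
    · refine ((𝒜.isHyperplane A hA).eq_of_le (𝒜.isHyperplane B hB) fun v hv => ?_).symm
      rw [← hbB, LinearMap.mem_ker]
      exact LinearMap.congr_fun h0 ⟨v, hv⟩
    · rw [LinearMap.ker_comp, hbB]

theorem complement_subset_deletion (𝒜 : Arrangement V) (A : Submodule ℍ[ℝ] V) :
    𝒜.complement ⊆ (𝒜.deletion A).complement :=
  Set.compl_subset_compl.mpr (Set.biUnion_subset_biUnion_left Set.sdiff_subset)

variable [TopologicalSpace V]

/-- The complement of an arrangement, as a topological space. -/
def space (𝒜 : Arrangement V) : TopCat.{u} := TopCat.of 𝒜.complement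

/-- The inclusion `X → X'` of the complement into the complement of the deletion. -/
def inclusion (𝒜 : Arrangement V) (A : Submodule ℍ[ℝ] V) :
    𝒜.space ⟶ (𝒜.deletion A).space :=
  TopCat.ofHom ⟨Set.inclusion (𝒜.complement_subset_deletion A), continuous_inclusion _⟩

end Arrangement

end QuaternionicArrangement

end

/-!
Let `X ⊆ X'` be the complements of an arrangement and of the deletion of a hyperplane `A`, and
`X''` that of the restriction to `A`. The difference `X' ∖ X` is `X''`, closed in `X'` with normal
bundle the trivial bundle with fibre `ℍ`, so excision and the Thom isomorphism give
`Hⁿ(X', X) ≅ Hⁿ⁻⁴(X'')`. By induction on the number of hyperplanes the cohomology of `X'` and of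
`X''` is concentrated in degrees divisible by three. As `3` cannot divide both `n` and `n - 4`, each
map `Hⁿ(X', X) ⟶ Hⁿ(X')` in the long exact sequence of the pair vanishes, and that sequence breaks
up into the required short ones; these in turn propagate the concentration to `X`.

Excision rests on the theorem of small simplices: the cochains vanishing on all simplices which lie
in one of the members of an open cover form an acyclic complex, because iterated barycentric
subdivision is homotopic to the identity and makes every simplex small. The Thom isomorphism for the
pair `(ℝ, ℝ ∖ 0)` follows from excision and homotopy invariance, and it is iterated four times.
-/

noncomputable section

/-! ### Singular cochains -/

namespace SingularCochain

open CategoryTheory Opposite Simplicial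

/-- The integral singular chain complex functor, with the coefficients lifted to the universe of
the spaces. -/
abbrev chainFunctor : TopCat.{u} ⥤ ChainComplex AddCommGrpCat.{u} ℕ :=
  (AlgebraicTopology.singularChainComplexFunctor AddCommGrpCat.{u}).obj
    (AddCommGrpCat.of (ULift.{u} ℤ))

/-- The functor `Hom(-; ℤ)` from chain complexes of abelian groups to cochain complexes. -/
def dualFunctor : (ChainComplex AddCommGrpCat.{u} ℕ)ᵒᵖ ⥤
    HomologicalComplex AddCommGrpCat.{u} (ComplexShape.down ℕ).symm :=
  HomologicalComplex.opFunctor AddCommGrpCat.{u} (ComplexShape.down ℕ) ⋙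
    (preadditiveYoneda.obj (AddCommGrpCat.of (ULift.{u} ℤ))).mapHomologicalComplex
      (ComplexShape.down ℕ).symm

/-- The integral singular cochain complex, whose cohomology is
`QuaternionicArrangement.singularCohomologyNat` by definition. -/
def cochainFunctor :
    TopCat.{u}ᵒᵖ ⥤ HomologicalComplex AddCommGrpCat.{u} (ComplexShape.down ℕ).symm :=
  chainFunctor.op ⋙ dualFunctor

/-- The topological standard `n`-simplex. -/
abbrev Simplex (n : ℕ) : Type := stdSimplex ℝ (Fin (n + 1))

/-- The inclusion of the face of the standard simplex opposite to the vertex `i`. -/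
def faceMap {n : ℕ} (i : Fin (n + 2)) : C(Simplex n, Simplex (n + 1)) :=
  ⟨stdSimplex.map i.succAbove, stdSimplex.continuous_map _⟩

/-- The inclusion into the singular chains of the summand `ℤ` of a singular simplex. -/
def chainι (X : TopCat.{u}) {n : ℕ} (σ : C(Simplex n, X)) :
    AddCommGrpCat.of (ULift.{u} ℤ) ⟶ (chainFunctor.obj X).X n :=
  (TopCat.toSSet.obj X).ιChainComplex ((TopCat.toSSetObjEquiv X (op ⦋n⦌)).symm σ)

theorem chainι_d (X : TopCat.{u}) {n : ℕ} (σ : C(Simplex (n + 1), X)) :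
    chainι X σ ≫ (chainFunctor.obj X).d (n + 1) n =
      ∑ i : Fin (n + 2), (-1 : ℤ) ^ (i : ℕ) • chainι X (σ.comp (faceMap i)) :=
  (TopCat.toSSet.obj X).ιChainComplex_d (R := AddCommGrpCat.of (ULift.{u} ℤ)) _

theorem chainι_map {X Y : TopCat.{u}} (f : X ⟶ Y) {n : ℕ} (σ : C(Simplex n, X)) :
    chainι X σ ≫ (chainFunctor.map f).f n = chainι Y (f.hom.comp σ) :=
  SSet.ι_chainComplexMap_f _ _ (TopCat.toSSet.map f) (AddCommGrpCat.of (ULift.{u} ℤ)) _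

/-- Evaluation of singular cochains on singular simplices, which identifies cochains with
functions on the set of singular simplices. -/
def equivFun (X : TopCat.{u}) (n : ℕ) :
    (cochainFunctor.obj (op X)).X n ≃+ (C(Simplex n, X) → ULift.{u} ℤ) where
  toFun φ σ := (chainι X σ ≫ (show (chainFunctor.obj X).X n ⟶
    AddCommGrpCat.of (ULift.{u} ℤ) from φ)).hom ⟨1⟩
  invFun f := Limits.Cofan.IsColimit.desc
    ((TopCat.toSSet.obj X).isColimitChainComplexXCofan (AddCommGrpCat.of (ULift.{u} ℤ)) n)
    fun x => AddCommGrpCat.ofHom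
      ((zmultiplesHom _ (f (TopCat.toSSetObjEquiv X (op ⦋n⦌) x))).comp
        AddEquiv.ulift.toAddMonoidHom)
  left_inv φ := by
    refine SSet.chainComplex_hom_ext fun x => ?_
    refine (Limits.Cofan.IsColimit.fac _ _ _).trans ?_
    ext z
    have hx : (TopCat.toSSetObjEquiv X (op ⦋n⦌)).symm (TopCat.toSSetObjEquiv X (op ⦋n⦌) x) = x :=
      Equiv.symm_apply_apply _ _
    have hz : z = z.down • (⟨1⟩ : ULift.{u} ℤ) := by ext; simp
    conv_rhs => rw [hz, map_zsmul]
    simp only [chainι, hx]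
    rfl
  right_inv f := by
    funext σ
    simp only [chainι]
    erw [Limits.Cofan.IsColimit.fac]
    exact (congrArg (fun τ => (1 : ℤ) • f τ) (Equiv.apply_symm_apply _ σ)).trans (one_zsmul _)
  map_add' φ ψ := rfl

theorem hom_sum_zsmul_comp_apply {ι : Type*} [Fintype ι] {A B D : AddCommGrpCat.{u}}
    (c : ι → ℤ) (g : ι → (A ⟶ B)) (φ : B ⟶ D) (x : A) :
    ((∑ i, c i • g i) ≫ φ).hom x = ∑ i, c i • (g i ≫ φ).hom x := by
  rw [Preadditive.sum_comp]
  let evalHom : (A ⟶ D) →+ D := ⟨⟨fun f => f.hom x, rfl⟩, fun _ _ => rfl⟩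
  refine (map_sum evalHom _ _).trans (Finset.sum_congr rfl fun i _ => ?_)
  simp [evalHom]

theorem equivFun_d (X : TopCat.{u}) (n : ℕ) (φ : (cochainFunctor.obj (op X)).X n)
    (σ : C(Simplex (n + 1), X)) :
    equivFun X (n + 1) ((cochainFunctor.obj (op X)).d n (n + 1) φ) σ =
      ∑ i : Fin (n + 2), (-1 : ℤ) ^ (i : ℕ) • equivFun X n φ (σ.comp (faceMap i)) :=
  (congrArg (fun g => (g ≫ (show (chainFunctor.obj X).X n ⟶
    AddCommGrpCat.of (ULift.{u} ℤ) from φ)).hom (⟨1⟩ : ULift.{u} ℤ)) (chainι_d X σ)).trans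
    (hom_sum_zsmul_comp_apply _ _ _ _)

theorem equivFun_map {X Y : TopCat.{u}} (f : X ⟶ Y) (n : ℕ)
    (φ : (cochainFunctor.obj (op Y)).X n) (σ : C(Simplex n, X)) :
    equivFun X n ((cochainFunctor.map f.op).f n φ) σ = equivFun Y n φ (f.hom.comp σ) :=
  congrArg (fun g => (g ≫ (show (chainFunctor.obj Y).X n ⟶
    AddCommGrpCat.of (ULift.{u} ℤ) from φ)).hom (⟨1⟩ : ULift.{u} ℤ)) (chainι_map f σ)

theorem homologyMap_dualFunctor_eq_of_homotopy {K L : ChainComplex AddCommGrpCat.{u} ℕ}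
    {f g : K ⟶ L} (h : Homotopy f g) (n : ℕ) :
    HomologicalComplex.homologyMap (dualFunctor.map f.op) n =
      HomologicalComplex.homologyMap (dualFunctor.map g.op) n :=
  ((preadditiveYoneda.obj (AddCommGrpCat.of (ULift.{u} ℤ))).mapHomotopy h.op).homologyMap_eq n

theorem homologyMap_eq_of_homotopy {X Y : TopCat.{u}} {f g : X ⟶ Y}
    (H : TopCat.Homotopy f g) (n : ℕ) :
    HomologicalComplex.homologyMap (cochainFunctor.map f.op) n =
      HomologicalComplex.homologyMap (cochainFunctor.map g.op) n :=
  homologyMap_dualFunctor_eq_of_homotopy (H.singularChainComplexFunctorObjMap _) n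

theorem quasiIso_map_of_homotopyEquiv {X Y : TopCat.{u}} (f : X ⟶ Y) (g : Y ⟶ X)
    (H : TopCat.Homotopy (f ≫ g) (𝟙 X)) (K : TopCat.Homotopy (g ≫ f) (𝟙 Y)) :
    QuasiIso (cochainFunctor.map f.op) := by
  rw [quasiIso_iff]
  intro n
  rw [quasiIsoAt_iff_isIso_homologyMap]
  refine ⟨HomologicalComplex.homologyMap (cochainFunctor.map g.op) n, ?_, ?_⟩
  · rw [← HomologicalComplex.homologyMap_comp, ← Functor.map_comp, ← op_comp,
      homologyMap_eq_of_homotopy K, op_id, CategoryTheory.Functor.map_id,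
      HomologicalComplex.homologyMap_id]
  · rw [← HomologicalComplex.homologyMap_comp, ← Functor.map_comp, ← op_comp,
      homologyMap_eq_of_homotopy H, op_id, CategoryTheory.Functor.map_id,
      HomologicalComplex.homologyMap_id]

end SingularCochain

/-! ### Barycentric subdivision -/

namespace SimplexSubdivision

open SingularCochain

section FormalChains

variable {P Q : Type*}

/-- Formal integral combinations of `n`-tuples of points, viewed as (possibly degenerate)
simplices with `n` vertices. The index is the number of vertices, one more than the dimension, so
that the complex is augmented. -/
abbrev TupleChain (P : Type*) (n : ℕ) : Type _ := (Fin n → P) →₀ ℤ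

theorem linearCombination_single_one {R α M : Type*} [Semiring R] [AddCommMonoid M] [Module R M]
    (f : α → M) (a : α) : Finsupp.linearCombination R f (Finsupp.single a 1) = f a := by
  rw [Finsupp.linearCombination_single, one_smul]

theorem linearMap_ext_single_one {R α M : Type*} [Semiring R] [AddCommMonoid M] [Module R M]
    {f g : (α →₀ R) →ₗ[R] M} (h : ∀ a, f (Finsupp.single a 1) = g (Finsupp.single a 1)) : f = g :=
  Finsupp.lhom_ext' fun a => LinearMap.ext_ring (h a)

/-- The boundary of formal chains: the alternating sum of the faces. -/
def boundary (P : Type*) (n : ℕ) : TupleChain P (n + 1) →ₗ[ℤ] TupleChain P n :=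
  Finsupp.linearCombination ℤ fun p =>
    ∑ i : Fin (n + 1), (-1 : ℤ) ^ (i : ℕ) • Finsupp.single (p ∘ i.succAbove) 1

/-- The cone over a formal chain with apex `x`, which is put in front of the other vertices. -/
def cone (x : P) (n : ℕ) : TupleChain P n →ₗ[ℤ] TupleChain P (n + 1) :=
  Finsupp.linearCombination ℤ fun p => Finsupp.single (Fin.cons x p) 1

/-- The map of formal chains induced by a map of points. -/
def mapChain (f : P → Q) (n : ℕ) : TupleChain P n →ₗ[ℤ] TupleChain Q n :=
  Finsupp.linearCombination ℤ fun p => Finsupp.single (f ∘ p) 1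

theorem boundary_single {n : ℕ} (p : Fin (n + 1) → P) :
    boundary P n (Finsupp.single p 1) =
      ∑ i : Fin (n + 1), (-1 : ℤ) ^ (i : ℕ) • Finsupp.single (p ∘ i.succAbove) 1 :=
  linearCombination_single_one _ _

theorem cone_single (x : P) {n : ℕ} (p : Fin n → P) :
    cone x n (Finsupp.single p 1) = Finsupp.single (Fin.cons x p) 1 :=
  linearCombination_single_one _ _

theorem mapChain_single (f : P → Q) {n : ℕ} (p : Fin n → P) :
    mapChain f n (Finsupp.single p 1) = Finsupp.single (f ∘ p) 1 :=
  linearCombination_single_one _ _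

theorem boundary_cone (x : P) (n : ℕ) (c : TupleChain P (n + 1)) :
    boundary P (n + 1) (cone x (n + 1) c) = c - cone x n (boundary P n c) := by
  suffices h : boundary P (n + 1) ∘ₗ cone x (n + 1) = LinearMap.id - cone x n ∘ₗ boundary P n from
    LinearMap.congr_fun h c
  refine linearMap_ext_single_one fun p => ?_
  simp only [LinearMap.comp_apply, LinearMap.sub_apply, LinearMap.id_apply, cone_single,
    boundary_single, map_sum, map_zsmul]
  rw [Fin.sum_univ_succ, sub_eq_add_neg, ← Finset.sum_neg_distrib]
  congr 1
  · simp only [Fin.val_zero, pow_zero, one_smul]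
    congr 1
  · refine Finset.sum_congr rfl fun i _ => ?_
    rw [Fin.val_succ, pow_succ, mul_neg_one, neg_smul]
    congr 3
    funext j
    refine Fin.cases ?_ (fun j => ?_) j <;> simp

theorem boundary_cone_zero (x : P) (c : TupleChain P 0) :
    boundary P 0 (cone x 0 c) = c := by
  suffices h : boundary P 0 ∘ₗ cone x 0 = LinearMap.id from LinearMap.congr_fun h c
  refine linearMap_ext_single_one fun p => ?_
  simp only [LinearMap.comp_apply, LinearMap.id_apply, cone_single, boundary_single]
  rw [Fin.sum_univ_one, Fin.val_zero, pow_zero, one_smul]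
  congr 1

theorem boundary_boundary (n : ℕ) (c : TupleChain P (n + 2)) :
    boundary P n (boundary P (n + 1) c) = 0 := by
  suffices h : ∀ n, boundary P n ∘ₗ boundary P (n + 1) = 0 from LinearMap.congr_fun (h n) c
  intro n
  induction n with
  | zero =>
    refine linearMap_ext_single_one fun p => ?_
    have hp : Finsupp.single p (1 : ℤ) = cone (p 0) 1 (Finsupp.single (Fin.tail p) 1) := by
      rw [cone_single, Fin.cons_self_tail]
    rw [LinearMap.comp_apply, hp, boundary_cone, map_sub, boundary_cone_zero, sub_self]
    rfl
  | succ n ih =>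
    refine linearMap_ext_single_one fun p => ?_
    have hp : Finsupp.single p (1 : ℤ) = cone (p 0) (n + 2) (Finsupp.single (Fin.tail p) 1) := by
      rw [cone_single, Fin.cons_self_tail]
    have ih' := LinearMap.congr_fun ih (Finsupp.single (Fin.tail p) 1)
    rw [LinearMap.comp_apply] at ih'
    rw [LinearMap.comp_apply, hp, boundary_cone, map_sub, boundary_cone, ih']
    simp

theorem mapChain_boundary (f : P → Q) (n : ℕ) (c : TupleChain P (n + 1)) :
    mapChain f n (boundary P n c) = boundary Q n (mapChain f (n + 1) c) := by
  suffices h : mapChain f n ∘ₗ boundary P n = boundary Q n ∘ₗ mapChain f (n + 1) from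
    LinearMap.congr_fun h c
  refine linearMap_ext_single_one fun p => ?_
  simp only [LinearMap.comp_apply, boundary_single, mapChain_single, map_sum, map_zsmul]
  rfl

theorem mapChain_cone (f : P → Q) (x : P) (n : ℕ) (c : TupleChain P n) :
    mapChain f (n + 1) (cone x n c) = cone (f x) n (mapChain f n c) := by
  suffices h : mapChain f (n + 1) ∘ₗ cone x n = cone (f x) n ∘ₗ mapChain f n from
    LinearMap.congr_fun h c
  refine linearMap_ext_single_one fun p => ?_
  simp only [LinearMap.comp_apply, cone_single, mapChain_single]
  congr 1
  funext j
  refine Fin.cases ?_ (fun j => ?_) j <;> simp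

variable (b : ∀ n : ℕ, (Fin (n + 1) → P) → P)

/-- Barycentric subdivision with respect to a choice `b` of an apex for each simplex. -/
def subdivision : ∀ n : ℕ, TupleChain P n →ₗ[ℤ] TupleChain P n
  | 0 => LinearMap.id
  | n + 1 => Finsupp.linearCombination ℤ fun p =>
      cone (b n p) n (subdivision n (boundary P n (Finsupp.single p 1)))

/-- The chain homotopy between the identity and `subdivision b`. -/
def subdivisionHomotopy : ∀ n : ℕ, TupleChain P n →ₗ[ℤ] TupleChain P (n + 1)
  | 0 => 0
  | n + 1 => Finsupp.linearCombination ℤ fun p => cone (b n p) (n + 1)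
      (Finsupp.single p 1 - subdivisionHomotopy n (boundary P n (Finsupp.single p 1)))

theorem subdivision_single (n : ℕ) (p : Fin (n + 1) → P) :
    subdivision b (n + 1) (Finsupp.single p 1) =
      cone (b n p) n (subdivision b n (boundary P n (Finsupp.single p 1))) :=
  linearCombination_single_one _ _

theorem subdivisionHomotopy_single (n : ℕ) (p : Fin (n + 1) → P) :
    subdivisionHomotopy b (n + 1) (Finsupp.single p 1) = cone (b n p) (n + 1)
      (Finsupp.single p 1 - subdivisionHomotopy b n (boundary P n (Finsupp.single p 1))) :=
  linearCombination_single_one _ _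

theorem boundary_subdivision (n : ℕ) (c : TupleChain P (n + 1)) :
    boundary P n (subdivision b (n + 1) c) = subdivision b n (boundary P n c) := by
  suffices h : ∀ n, boundary P n ∘ₗ subdivision b (n + 1) = subdivision b n ∘ₗ boundary P n from
    LinearMap.congr_fun (h n) c
  intro n
  induction n with
  | zero =>
    refine linearMap_ext_single_one fun p => ?_
    rw [LinearMap.comp_apply, subdivision_single, boundary_cone_zero, LinearMap.comp_apply]
  | succ n ih =>
    refine linearMap_ext_single_one fun p => ?_
    have ih' := LinearMap.congr_fun ih (boundary P (n + 1) (Finsupp.single p 1))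
    rw [LinearMap.comp_apply, LinearMap.comp_apply, boundary_boundary, map_zero] at ih'
    rw [LinearMap.comp_apply, subdivision_single, boundary_cone, ih', map_zero, sub_zero,
      LinearMap.comp_apply]

theorem boundary_subdivisionHomotopy (n : ℕ) (c : TupleChain P (n + 1)) :
    boundary P (n + 1) (subdivisionHomotopy b (n + 1) c) =
      c - subdivision b (n + 1) c - subdivisionHomotopy b n (boundary P n c) := by
  suffices h : ∀ n, boundary P (n + 1) ∘ₗ subdivisionHomotopy b (n + 1) =
      LinearMap.id - subdivision b (n + 1) - subdivisionHomotopy b n ∘ₗ boundary P n from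
    LinearMap.congr_fun (h n) c
  intro n
  induction n with
  | zero =>
    refine linearMap_ext_single_one fun p => ?_
    simp only [LinearMap.comp_apply, LinearMap.sub_apply, LinearMap.id_apply]
    rw [subdivisionHomotopy_single, boundary_cone, subdivision_single]
    simp [subdivisionHomotopy, subdivision]
  | succ n ih =>
    refine linearMap_ext_single_one fun p => ?_
    have ih' := LinearMap.congr_fun ih (boundary P (n + 1) (Finsupp.single p 1))
    simp only [LinearMap.comp_apply, LinearMap.sub_apply, LinearMap.id_apply, boundary_boundary,
      map_zero, sub_zero] at ih'
    simp only [LinearMap.comp_apply, LinearMap.sub_apply, LinearMap.id_apply]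
    rw [subdivisionHomotopy_single, boundary_cone, subdivision_single, map_sub (boundary P (n + 1)),
      ih', sub_sub_cancel]
    abel

theorem mapChain_subdivision {b' : ∀ n : ℕ, (Fin (n + 1) → Q) → Q} {f : P → Q}
    (hf : ∀ n p, f (b n p) = b' n (f ∘ p)) (n : ℕ) (c : TupleChain P n) :
    mapChain f n (subdivision b n c) = subdivision b' n (mapChain f n c) := by
  suffices h : ∀ n, mapChain f n ∘ₗ subdivision b n = subdivision b' n ∘ₗ mapChain f n from
    LinearMap.congr_fun (h n) c
  intro n
  induction n with
  | zero => rfl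
  | succ n ih =>
    refine linearMap_ext_single_one fun p => ?_
    have ih' := LinearMap.congr_fun ih (boundary P n (Finsupp.single p 1))
    simp only [LinearMap.comp_apply] at ih' ⊢
    rw [subdivision_single, mapChain_cone, ih', mapChain_boundary, mapChain_single,
      subdivision_single, hf]

theorem mapChain_subdivisionHomotopy {b' : ∀ n : ℕ, (Fin (n + 1) → Q) → Q} {f : P → Q}
    (hf : ∀ n p, f (b n p) = b' n (f ∘ p)) (n : ℕ) (c : TupleChain P n) :
    mapChain f (n + 1) (subdivisionHomotopy b n c) =
      subdivisionHomotopy b' n (mapChain f n c) := by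
  suffices h : ∀ n, mapChain f (n + 1) ∘ₗ subdivisionHomotopy b n =
      subdivisionHomotopy b' n ∘ₗ mapChain f n from LinearMap.congr_fun (h n) c
  intro n
  induction n with
  | zero => simp [subdivisionHomotopy]
  | succ n ih =>
    refine linearMap_ext_single_one fun p => ?_
    have ih' := LinearMap.congr_fun ih (boundary P n (Finsupp.single p 1))
    simp only [LinearMap.comp_apply] at ih' ⊢
    rw [subdivisionHomotopy_single, mapChain_cone, map_sub, ih', mapChain_boundary,
      mapChain_single, subdivisionHomotopy_single, hf]

end FormalChains

section SingularChains

/-- The affine simplex in `Simplex n` with prescribed vertices. -/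
def affineSimplex {m n : ℕ} (p : Fin (m + 1) → Simplex n) : C(Simplex m, Simplex n) where
  toFun t := ⟨∑ i, t i • (p i : Fin (n + 1) → ℝ), (convex_stdSimplex ℝ _).sum_mem
    (fun i _ => t.2.1 i) t.2.2 fun i _ => (p i).2⟩
  continuous_toFun := by
    refine Continuous.subtype_mk (continuous_finsetSum _ fun i _ => ?_) _
    exact ((continuous_apply i).comp continuous_subtype_val).smul continuous_const

theorem affineSimplex_apply {m n : ℕ} (p : Fin (m + 1) → Simplex n) (t : Simplex m)
    (k : Fin (n + 1)) : affineSimplex p t k = ∑ i, t i * p i k := by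
  change (∑ i, t i • (p i : Fin (n + 1) → ℝ)) k = _
  rw [Finset.sum_apply]
  rfl

/-- The vertices of the standard simplex, as the tuple that spans it. -/
def vertices (n : ℕ) : Fin (n + 1) → Simplex n := fun i => stdSimplex.vertex i

theorem affineSimplex_vertices_apply {m n : ℕ} (p : Fin (m + 1) → Simplex n) (i : Fin (m + 1)) :
    affineSimplex p (vertices m i) = p i := by
  ext k
  rw [affineSimplex_apply]
  simp [vertices, Pi.single_apply]

theorem affineSimplex_comp_vertices {m n : ℕ} (p : Fin (m + 1) → Simplex n) :
    affineSimplex p ∘ vertices m = p :=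
  funext (affineSimplex_vertices_apply p)

theorem affineSimplex_vertices (n : ℕ) :
    affineSimplex (vertices n) = ContinuousMap.id (Simplex n) := by
  ext t k
  rw [affineSimplex_apply]
  simp [vertices, Pi.single_apply]

theorem affineSimplex_comp {k m n : ℕ} (p : Fin (m + 1) → Simplex n)
    (q : Fin (k + 1) → Simplex m) :
    (affineSimplex p).comp (affineSimplex q) = affineSimplex (affineSimplex p ∘ q) := by
  ext t l
  simp only [ContinuousMap.comp_apply, affineSimplex_apply, Function.comp_apply, Finset.sum_mul,
    Finset.mul_sum, mul_assoc]
  exact Finset.sum_comm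

theorem faceMap_eq {n : ℕ} (i : Fin (n + 2)) :
    faceMap i = affineSimplex (vertices (n + 1) ∘ i.succAbove) := by
  ext t k
  rw [affineSimplex_apply]
  simp [faceMap, vertices, Pi.single_apply, FunOnFinite.linearMap_apply_apply,
    Finset.sum_filter, eq_comm]

theorem affineSimplex_comp_faceMap {m n : ℕ} (p : Fin (m + 2) → Simplex n) (i : Fin (m + 2)) :
    (affineSimplex p).comp (faceMap i) = affineSimplex (p ∘ i.succAbove) := by
  rw [faceMap_eq, affineSimplex_comp]
  congr 1
  funext j
  exact affineSimplex_vertices_apply p _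

/-- The barycenter of an affine simplex, the choice of apex for the subdivision of chains in
`Simplex n`. -/
def barycenter (n m : ℕ) (p : Fin (m + 1) → Simplex n) : Simplex n :=
  affineSimplex p stdSimplex.barycenter

theorem affineSimplex_barycenter {k n : ℕ} (p : Fin (k + 1) → Simplex n) (m : ℕ)
    (q : Fin (m + 1) → Simplex k) :
    affineSimplex p (barycenter k m q) = barycenter n m (affineSimplex p ∘ q) := by
  rw [barycenter, barycenter, ← affineSimplex_comp]
  rfl

variable {X : Type*} [TopologicalSpace X]

variable (X) in
/-- Singular chains, as formal combinations of singular simplices. -/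
abbrev SingularChain (n : ℕ) : Type _ := C(Simplex n, X) →₀ ℤ

variable (X) in
/-- The boundary of singular chains: the alternating sum of the faces. -/
def singularBoundary (n : ℕ) : SingularChain X (n + 1) →ₗ[ℤ] SingularChain X n :=
  Finsupp.linearCombination ℤ fun σ =>
    ∑ i : Fin (n + 2), (-1 : ℤ) ^ (i : ℕ) • Finsupp.single (σ.comp (faceMap i)) 1

theorem singularBoundary_single {n : ℕ} (σ : C(Simplex (n + 1), X)) :
    singularBoundary X n (Finsupp.single σ 1) =
      ∑ i : Fin (n + 2), (-1 : ℤ) ^ (i : ℕ) • Finsupp.single (σ.comp (faceMap i)) 1 :=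
  linearCombination_single_one _ _

/-- The singular chain in `X` given by a formal combination of affine simplices in `Simplex n`
and a singular simplex of `X`. -/
def realize {n : ℕ} (σ : C(Simplex n, X)) (m : ℕ) :
    TupleChain (Simplex n) (m + 1) →ₗ[ℤ] SingularChain X m :=
  Finsupp.linearCombination ℤ fun p => Finsupp.single (σ.comp (affineSimplex p)) 1

theorem realize_single {n : ℕ} (σ : C(Simplex n, X)) {m : ℕ} (p : Fin (m + 1) → Simplex n) :
    realize σ m (Finsupp.single p 1) = Finsupp.single (σ.comp (affineSimplex p)) 1 :=
  linearCombination_single_one _ _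

theorem realize_vertices {n : ℕ} (σ : C(Simplex n, X)) :
    realize σ n (Finsupp.single (vertices n) 1) = Finsupp.single σ 1 := by
  rw [realize_single, affineSimplex_vertices, ContinuousMap.comp_id]

theorem singularBoundary_realize {n : ℕ} (σ : C(Simplex n, X)) (m : ℕ)
    (c : TupleChain (Simplex n) (m + 2)) :
    singularBoundary X m (realize σ (m + 1) c) = realize σ m (boundary _ (m + 1) c) := by
  suffices h : singularBoundary X m ∘ₗ realize σ (m + 1) = realize σ m ∘ₗ boundary _ (m + 1) from
    LinearMap.congr_fun h c
  refine linearMap_ext_single_one fun p => ?_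
  simp only [LinearMap.comp_apply, realize_single, singularBoundary_single, boundary_single,
    map_sum, map_zsmul, ContinuousMap.comp_assoc, affineSimplex_comp_faceMap]

theorem realize_comp_affineSimplex {k n : ℕ} (σ : C(Simplex n, X)) (p : Fin (k + 1) → Simplex n)
    (m : ℕ) (c : TupleChain (Simplex k) (m + 1)) :
    realize (σ.comp (affineSimplex p)) m c =
      realize σ m (mapChain (affineSimplex p) (m + 1) c) := by
  suffices h : realize (σ.comp (affineSimplex p)) m =
      realize σ m ∘ₗ mapChain (affineSimplex p) (m + 1) from LinearMap.congr_fun h c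
  refine linearMap_ext_single_one fun q => ?_
  simp only [LinearMap.comp_apply, realize_single, mapChain_single, ContinuousMap.comp_assoc,
    affineSimplex_comp]

variable (X) in
/-- Barycentric subdivision of singular chains. -/
def singularSubdivision (n : ℕ) : SingularChain X n →ₗ[ℤ] SingularChain X n :=
  Finsupp.linearCombination ℤ fun σ =>
    realize σ n (subdivision (barycenter n) (n + 1) (Finsupp.single (vertices n) 1))

variable (X) in
/-- The chain homotopy between the identity and barycentric subdivision of singular chains. -/
def singularHomotopy (n : ℕ) : SingularChain X n →ₗ[ℤ] SingularChain X (n + 1) :=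
  Finsupp.linearCombination ℤ fun σ => realize σ (n + 1)
    (subdivisionHomotopy (barycenter n) (n + 1) (Finsupp.single (vertices n) 1))

theorem singularSubdivision_realize {n : ℕ} (σ : C(Simplex n, X)) (m : ℕ)
    (c : TupleChain (Simplex n) (m + 1)) :
    singularSubdivision X m (realize σ m c) =
      realize σ m (subdivision (barycenter n) (m + 1) c) := by
  suffices h : singularSubdivision X m ∘ₗ realize σ m =
      realize σ m ∘ₗ subdivision (barycenter n) (m + 1) from LinearMap.congr_fun h c
  refine linearMap_ext_single_one fun p => ?_
  rw [LinearMap.comp_apply, realize_single, singularSubdivision, linearCombination_single_one,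
    realize_comp_affineSimplex, mapChain_subdivision _ (affineSimplex_barycenter p),
    mapChain_single, affineSimplex_comp_vertices, LinearMap.comp_apply]

theorem singularHomotopy_realize {n : ℕ} (σ : C(Simplex n, X)) (m : ℕ)
    (c : TupleChain (Simplex n) (m + 1)) :
    singularHomotopy X m (realize σ m c) =
      realize σ (m + 1) (subdivisionHomotopy (barycenter n) (m + 1) c) := by
  suffices h : singularHomotopy X m ∘ₗ realize σ m =
      realize σ (m + 1) ∘ₗ subdivisionHomotopy (barycenter n) (m + 1) from
    LinearMap.congr_fun h c
  refine linearMap_ext_single_one fun p => ?_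
  rw [LinearMap.comp_apply, realize_single, singularHomotopy, linearCombination_single_one,
    realize_comp_affineSimplex, mapChain_subdivisionHomotopy _ (affineSimplex_barycenter p),
    mapChain_single, affineSimplex_comp_vertices, LinearMap.comp_apply]

theorem singularBoundary_subdivision (n : ℕ) (c : SingularChain X (n + 1)) :
    singularBoundary X n (singularSubdivision X (n + 1) c) =
      singularSubdivision X n (singularBoundary X n c) := by
  suffices h : singularBoundary X n ∘ₗ singularSubdivision X (n + 1) =
      singularSubdivision X n ∘ₗ singularBoundary X n from LinearMap.congr_fun h c
  refine linearMap_ext_single_one fun σ => ?_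
  rw [LinearMap.comp_apply, LinearMap.comp_apply, ← realize_vertices σ,
    singularSubdivision_realize, singularBoundary_realize, boundary_subdivision,
    singularBoundary_realize, singularSubdivision_realize]

theorem singularBoundary_homotopy (n : ℕ) (c : SingularChain X (n + 1)) :
    singularBoundary X (n + 1) (singularHomotopy X (n + 1) c) =
      c - singularSubdivision X (n + 1) c - singularHomotopy X n (singularBoundary X n c) := by
  suffices h : singularBoundary X (n + 1) ∘ₗ singularHomotopy X (n + 1) = LinearMap.id -
      singularSubdivision X (n + 1) - singularHomotopy X n ∘ₗ singularBoundary X n from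
    LinearMap.congr_fun h c
  refine linearMap_ext_single_one fun σ => ?_
  rw [LinearMap.comp_apply, LinearMap.sub_apply, LinearMap.sub_apply, LinearMap.id_apply,
    LinearMap.comp_apply, ← realize_vertices σ, singularSubdivision_realize,
    singularHomotopy_realize, singularBoundary_realize, boundary_subdivisionHomotopy,
    singularBoundary_realize, singularHomotopy_realize, map_sub, map_sub]

variable (X) in
/-- The chain homotopy between the identity and the `N`-fold barycentric subdivision. -/
def iteratedHomotopy (n N : ℕ) : SingularChain X n →ₗ[ℤ] SingularChain X (n + 1) :=
  ∑ j ∈ Finset.range N, singularHomotopy X n ∘ₗ singularSubdivision X n ^ j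

theorem iteratedHomotopy_apply (n N : ℕ) (c : SingularChain X n) :
    iteratedHomotopy X n N c =
      ∑ j ∈ Finset.range N, singularHomotopy X n ((singularSubdivision X n ^ j) c) := by
  simp [iteratedHomotopy]

theorem singularBoundary_subdivision_pow (n j : ℕ) (c : SingularChain X (n + 1)) :
    singularBoundary X n ((singularSubdivision X (n + 1) ^ j) c) =
      (singularSubdivision X n ^ j) (singularBoundary X n c) := by
  induction j with
  | zero => simp
  | succ j ih =>
    rw [pow_succ', pow_succ', Module.End.mul_apply, Module.End.mul_apply,
      singularBoundary_subdivision, ih]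

theorem singularBoundary_iteratedHomotopy (n N : ℕ) (c : SingularChain X (n + 1)) :
    singularBoundary X (n + 1) (iteratedHomotopy X (n + 1) N c) =
      c - (singularSubdivision X (n + 1) ^ N) c -
        iteratedHomotopy X n N (singularBoundary X n c) := by
  induction N with
  | zero => simp [iteratedHomotopy_apply]
  | succ N ih =>
    rw [iteratedHomotopy_apply, Finset.sum_range_succ, map_add, ← iteratedHomotopy_apply, ih,
      singularBoundary_homotopy, iteratedHomotopy_apply, iteratedHomotopy_apply,
      Finset.sum_range_succ, singularBoundary_subdivision_pow, pow_succ' _ N,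
      Module.End.mul_apply]
    abel

end SingularChains

section SmallChains

theorem linearCombination_mem {R α M : Type*} [Semiring R] [AddCommMonoid M] [Module R M]
    {f : α → M} {N : Submodule R M} (h : ∀ a, f a ∈ N) (c : α →₀ R) :
    Finsupp.linearCombination R f c ∈ N := by
  rw [Finsupp.linearCombination_apply]
  exact N.sum_mem fun a _ => N.smul_mem _ (h a)

theorem map_mem_of_mem_span {R M M' : Type*} [Semiring R] [AddCommMonoid M] [AddCommMonoid M']
    [Module R M] [Module R M'] (f : M →ₗ[R] M') {s : Set M} {N : Submodule R M'}
    (h : ∀ x ∈ s, f x ∈ N) {c : M} (hc : c ∈ Submodule.span R s) : f c ∈ N :=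
  (Submodule.map_span_le f s N).2 h (Submodule.mem_map_of_mem hc)

/-- The convex hull of the vertices of a tuple. -/
def tupleHull {n k : ℕ} (p : Fin k → Simplex n) : Set (Fin (n + 1) → ℝ) :=
  convexHull ℝ (Set.range fun i => (p i : Fin (n + 1) → ℝ))

theorem tupleHull_comp_subset {n k l : ℕ} (p : Fin k → Simplex n) (f : Fin l → Fin k) :
    tupleHull (p ∘ f) ⊆ tupleHull p :=
  convexHull_mono (Set.range_subset_iff.2 fun a => ⟨f a, rfl⟩)

theorem coe_affineSimplex_mem_tupleHull {n m : ℕ} (p : Fin (m + 1) → Simplex n) (t : Simplex m) :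
    (affineSimplex p t).1 ∈ tupleHull p :=
  (convex_convexHull ℝ _).sum_mem (fun i _ => t.2.1 i) t.2.2
    fun i _ => subset_convexHull ℝ _ ⟨i, rfl⟩

theorem dist_le_of_mem_tupleHull {n k : ℕ} {p : Fin k → Simplex n} {x y : Simplex n} {d : ℝ}
    (hy : y.1 ∈ tupleHull p) (h : ∀ i, dist (p i) x ≤ d) : dist y x ≤ d := by
  have : tupleHull p ⊆ Metric.closedBall x.1 d :=
    convexHull_min (Set.range_subset_iff.2 h) (convex_closedBall _ _)
  exact this hy

theorem coe_barycenter {n k : ℕ} (p : Fin (k + 1) → Simplex n) :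
    (barycenter n k p).1 = ((k : ℝ) + 1)⁻¹ • ∑ i, (p i).1 := by
  have hcoord (i : Fin (k + 1)) : (stdSimplex.barycenter : Simplex k) i = ((k : ℝ) + 1)⁻¹ :=
    (stdSimplex.barycenter_apply i).trans (by simp)
  rw [Finset.smul_sum]
  change ∑ i, (stdSimplex.barycenter : Simplex k) i • (p i).1 = _
  exact Finset.sum_congr rfl fun i _ => congrArg (· • (p i).1) (hcoord i)

theorem dist_inv_smul_sum_le {E : Type*} [SeminormedAddCommGroup E] [NormedSpace ℝ E] {k : ℕ}
    {p : Fin (k + 1) → E} {d : ℝ} (hp : ∀ i j, dist (p i) (p j) ≤ d) (j : Fin (k + 1)) :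
    dist (p j) (((k : ℝ) + 1)⁻¹ • ∑ i, p i) ≤ k / (k + 1) * d := by
  have hk : (0 : ℝ) < k + 1 := by positivity
  have hsub : p j - ((k : ℝ) + 1)⁻¹ • ∑ i, p i = ((k : ℝ) + 1)⁻¹ • ∑ i, (p j - p i) := by
    rw [Finset.sum_sub_distrib, smul_sub, Finset.sum_const, Finset.card_univ, Fintype.card_fin,
      ← Nat.cast_smul_eq_nsmul ℝ, Nat.cast_succ, inv_smul_smul₀ hk.ne']
  have hsum : ‖∑ i, (p j - p i)‖ ≤ k * d := by
    rw [Fin.sum_univ_succAbove _ j, sub_self, zero_add]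
    refine (norm_sum_le_of_le _ fun i _ => (dist_eq_norm (p j) _).symm.trans_le (hp j _)).trans ?_
    simp
  rw [dist_eq_norm, hsub, norm_smul, norm_inv, Real.norm_of_nonneg hk.le, ← div_eq_inv_mul,
    div_mul_eq_mul_div]
  gcongr

theorem dist_barycenter_le {n k : ℕ} {p : Fin (k + 1) → Simplex n} {d : ℝ}
    (hp : ∀ i j, dist (p i) (p j) ≤ d) (j : Fin (k + 1)) :
    dist (p j) (barycenter n k p) ≤ k / (k + 1) * d := by
  rw [Subtype.dist_eq, coe_barycenter]
  exact dist_inv_smul_sum_le (p := fun i => (p i).1) hp j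

/-- The chains supported on tuples of diameter at most `d` with vertices in `s`. -/
def fineChain (n k : ℕ) (s : Set (Fin (n + 1) → ℝ)) (d : ℝ) :
    Submodule ℤ (TupleChain (Simplex n) k) :=
  Submodule.span ℤ {c | ∃ q : Fin k → Simplex n, Finsupp.single q 1 = c ∧ (∀ i, (q i).1 ∈ s) ∧
    ∀ i j, dist (q i) (q j) ≤ d}

theorem single_mem_fineChain {n k : ℕ} {s : Set (Fin (n + 1) → ℝ)} {d : ℝ}
    {q : Fin k → Simplex n} (hs : ∀ i, (q i).1 ∈ s) (hd : ∀ i j, dist (q i) (q j) ≤ d) :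
    Finsupp.single q 1 ∈ fineChain n k s d :=
  Submodule.subset_span ⟨q, rfl, hs, hd⟩

theorem fineChain_mono {n k : ℕ} {s t : Set (Fin (n + 1) → ℝ)} {d : ℝ} (h : s ⊆ t) :
    fineChain n k s d ≤ fineChain n k t d := by
  refine Submodule.span_mono ?_
  rintro _ ⟨q, rfl, hs, hd⟩
  exact ⟨q, rfl, fun i => h (hs i), hd⟩

theorem cone_mem_fineChain {n k : ℕ} {s : Set (Fin (n + 1) → ℝ)} {d : ℝ} (hd : 0 ≤ d)
    {x : Simplex n} (hx : x.1 ∈ s) (h : ∀ y : Simplex n, y.1 ∈ s → dist y x ≤ d)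
    {c : TupleChain (Simplex n) k} (hc : c ∈ fineChain n k s d) :
    cone x k c ∈ fineChain n (k + 1) s d := by
  refine map_mem_of_mem_span (cone x k) ?_ hc
  rintro _ ⟨q, rfl, hqs, hqd⟩
  rw [cone_single]
  refine single_mem_fineChain (Fin.cases hx hqs) (Fin.cases (Fin.cases ?_ fun j => ?_) fun i =>
    Fin.cases ?_ fun j => ?_)
  · simpa using hd
  · simpa [dist_comm] using h _ (hqs j)
  · simpa using h _ (hqs i)
  · simpa using hqd i j

theorem subdivision_single_mem_fineChain {n : ℕ} {r d : ℝ}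
    (k : ℕ) (hr : ∀ m : ℕ, m < k → (m : ℝ) / (m + 1) ≤ r)
    (p : Fin k → Simplex n) (hp : ∀ i j, dist (p i) (p j) ≤ d) :
    subdivision (barycenter n) k (Finsupp.single p 1) ∈ fineChain n k (tupleHull p) (r * d) := by
  induction k with
  | zero => exact single_mem_fineChain (fun i => i.elim0) fun i => i.elim0
  | succ k ih =>
    have hd : 0 ≤ d := by simpa using hp 0 0
    have hrk : (k : ℝ) / (k + 1) ≤ r := hr k k.lt_succ_self
    have hr0 : 0 ≤ r := le_trans (by positivity) hrk
    rw [subdivision_single, boundary_single, map_sum, map_sum]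
    refine Submodule.sum_mem _ fun i _ => ?_
    rw [map_zsmul, map_zsmul]
    refine Submodule.smul_mem _ _ (cone_mem_fineChain (mul_nonneg hr0 hd)
      (coe_affineSimplex_mem_tupleHull p _) (fun y hy => ?_) ?_)
    · exact dist_le_of_mem_tupleHull hy fun l =>
        (dist_barycenter_le hp l).trans (mul_le_mul_of_nonneg_right hrk hd)
    · exact fineChain_mono (tupleHull_comp_subset p _)
        (ih (fun m hm => hr m (hm.trans k.lt_succ_self)) _ fun a b => hp _ _)

theorem subdivision_mem_fineChain {n : ℕ} {d : ℝ} {c : TupleChain (Simplex n) (n + 1)}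
    (hc : c ∈ fineChain n (n + 1) Set.univ d) :
    subdivision (barycenter n) (n + 1) c ∈ fineChain n (n + 1) Set.univ (n / (n + 1) * d) := by
  have hr : ∀ m : ℕ, m < n + 1 → (m : ℝ) / (m + 1) ≤ n / (n + 1) := by
    intro m hm
    have : (m : ℝ) ≤ n := by exact_mod_cast Nat.lt_succ_iff.1 hm
    rw [div_le_div_iff₀ (by positivity) (by positivity)]
    linarith
  refine map_mem_of_mem_span _ ?_ hc
  rintro _ ⟨q, rfl, -, hq⟩
  exact fineChain_mono (Set.subset_univ _) (subdivision_single_mem_fineChain _ hr q hq)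

theorem subdivision_pow_vertices_mem_fineChain (n N : ℕ) :
    (subdivision (barycenter n) (n + 1) ^ N) (Finsupp.single (vertices n) 1) ∈
      fineChain n (n + 1) Set.univ ((n / (n + 1) : ℝ) ^ N) := by
  induction N with
  | zero =>
    refine single_mem_fineChain (fun _ => trivial) fun i j => ?_
    rw [pow_zero]
    exact (Metric.dist_le_diam_of_mem (bounded_stdSimplex _) (vertices n i).2
      (vertices n j).2).trans diam_stdSimplex_le
  | succ N ih =>
    rw [pow_succ', pow_succ', Module.End.mul_apply]
    exact subdivision_mem_fineChain ih

/-- A set is small with respect to a family of sets if it is contained in one of them. -/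
def IsSmall {X : Type*} (𝒰 : Set (Set X)) (s : Set X) : Prop := ∃ U ∈ 𝒰, s ⊆ U

theorem IsSmall.mono {X : Type*} {𝒰 : Set (Set X)} {s t : Set X} (ht : IsSmall 𝒰 t)
    (h : s ⊆ t) : IsSmall 𝒰 s :=
  ht.imp fun _ hU => ⟨hU.1, h.trans hU.2⟩

variable {X : Type*} [TopologicalSpace X]

/-- The singular chains supported on simplices whose image is small with respect to `𝒰`. -/
def smallChain (𝒰 : Set (Set X)) (n : ℕ) : Submodule ℤ (SingularChain X n) :=
  Submodule.span ℤ {c | ∃ σ : C(Simplex n, X), Finsupp.single σ 1 = c ∧ IsSmall 𝒰 (Set.range σ)}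

theorem realize_mem_smallChain {𝒰 : Set (Set X)} {n : ℕ} {σ : C(Simplex n, X)}
    (h : IsSmall 𝒰 (Set.range σ)) (m : ℕ) (c : TupleChain (Simplex n) (m + 1)) :
    realize σ m c ∈ smallChain 𝒰 m :=
  linearCombination_mem (N := smallChain 𝒰 m) (fun p => Submodule.subset_span
    ⟨σ.comp (affineSimplex p), rfl, h.mono (Set.range_comp_subset_range _ σ)⟩) c

theorem singularSubdivision_mem_smallChain {𝒰 : Set (Set X)} {n : ℕ} {c : SingularChain X n}
    (hc : c ∈ smallChain 𝒰 n) : singularSubdivision X n c ∈ smallChain 𝒰 n := by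
  refine map_mem_of_mem_span _ ?_ hc
  rintro _ ⟨σ, rfl, hσ⟩
  rw [singularSubdivision, linearCombination_single_one]
  exact realize_mem_smallChain hσ _ _

theorem singularHomotopy_mem_smallChain {𝒰 : Set (Set X)} {n : ℕ} {c : SingularChain X n}
    (hc : c ∈ smallChain 𝒰 n) : singularHomotopy X n c ∈ smallChain 𝒰 (n + 1) := by
  refine map_mem_of_mem_span _ ?_ hc
  rintro _ ⟨σ, rfl, hσ⟩
  rw [singularHomotopy, linearCombination_single_one]
  exact realize_mem_smallChain hσ _ _

theorem singularSubdivision_pow_mem_smallChain {𝒰 : Set (Set X)} {n : ℕ} {c : SingularChain X n}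
    {N M : ℕ} (hc : (singularSubdivision X n ^ N) c ∈ smallChain 𝒰 n) (h : N ≤ M) :
    (singularSubdivision X n ^ M) c ∈ smallChain 𝒰 n := by
  induction M, h using Nat.le_induction with
  | base => exact hc
  | succ M _ ih =>
    rw [pow_succ', Module.End.mul_apply]
    exact singularSubdivision_mem_smallChain ih

theorem singularSubdivision_pow_realize {n : ℕ} (σ : C(Simplex n, X)) (m N : ℕ)
    (c : TupleChain (Simplex n) (m + 1)) :
    (singularSubdivision X m ^ N) (realize σ m c) =
      realize σ m ((subdivision (barycenter n) (m + 1) ^ N) c) := by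
  induction N with
  | zero => simp
  | succ N ih =>
    rw [pow_succ', pow_succ', Module.End.mul_apply, Module.End.mul_apply, ih,
      singularSubdivision_realize]

theorem exists_singularSubdivision_pow_mem_smallChain {𝒰 : Set (Set X)}
    (ho : ∀ U ∈ 𝒰, IsOpen U) (hc : ⋃₀ 𝒰 = Set.univ) {n : ℕ} (σ : C(Simplex n, X)) :
    ∃ N : ℕ, (singularSubdivision X n ^ N) (Finsupp.single σ 1) ∈ smallChain 𝒰 n := by
  have : CompactSpace (Simplex n) := isCompact_iff_compactSpace.1 (isCompact_stdSimplex _ _)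
  obtain ⟨δ, hδ, hball⟩ := lebesgue_number_lemma_of_metric (c := fun U : 𝒰 => σ ⁻¹' U.1)
    (isCompact_univ (X := Simplex n)) (fun U => (ho U.1 U.2).preimage σ.continuous) (by
      intro x _
      obtain ⟨U, hU, hx⟩ := (hc.symm ▸ Set.mem_univ (σ x) : σ x ∈ ⋃₀ 𝒰)
      exact Set.mem_iUnion.2 ⟨⟨U, hU⟩, hx⟩)
  obtain ⟨N, hN⟩ := exists_pow_lt_of_lt_one hδ (y := (n / (n + 1) : ℝ))
    (by rw [div_lt_one (by positivity)]; linarith)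
  refine ⟨N, ?_⟩
  rw [← realize_vertices σ, singularSubdivision_pow_realize]
  refine map_mem_of_mem_span _ ?_ (subdivision_pow_vertices_mem_fineChain n N)
  rintro _ ⟨q, rfl, -, hq⟩
  rw [realize_single]
  obtain ⟨U, hU⟩ := hball (q 0) (Set.mem_univ _)
  refine Submodule.subset_span ⟨_, rfl, U.1, U.2, Set.range_subset_iff.2 fun t => hU ?_⟩
  exact (dist_le_of_mem_tupleHull (coe_affineSimplex_mem_tupleHull q t)
    fun i => hq i 0).trans_lt hN

end SmallChains

end SimplexSubdivision

/-! ### Relative cochains -/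

namespace SingularCochain

open CategoryTheory Opposite SimplexSubdivision

section Subcomplex

variable {ι : Type*} {c : ComplexShape ι} (K : HomologicalComplex AddCommGrpCat.{u} c)
  (S : ∀ i, AddSubgroup (K.X i)) (hS : ∀ i j, ∀ x ∈ S i, K.d i j x ∈ S j)

/-- The subcomplex given by a family of subgroups stable under the differential. -/
def subcomplex : HomologicalComplex AddCommGrpCat.{u} c where
  X i := AddCommGrpCat.of (S i)
  d i j := AddCommGrpCat.ofHom
    (((K.d i j).hom.comp (S i).subtype).codRestrict (S j) fun x => hS i j x x.2)
  shape i j hij := by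
    ext x
    change K.d i j x.1 = 0
    rw [K.shape i j hij]
    rfl
  d_comp_d' i j k _ _ := by
    ext x
    exact ConcreteCategory.congr_hom (K.d_comp_d i j k) (x.1 : K.X i)

end Subcomplex

variable {X Y Z : TopCat.{u}} {𝒰 : Set (Set X)} {𝒱 : Set (Set Y)} {𝒲 : Set (Set Z)}

/-- The cochains which vanish on all `𝒰`-small simplices. -/
def vanishing (X : TopCat.{u}) (𝒰 : Set (Set X)) (n : ℕ) :
    AddSubgroup ((cochainFunctor.obj (op X)).X n) where
  carrier := {φ | ∀ σ : C(Simplex n, X), IsSmall 𝒰 (Set.range σ) → equivFun X n φ σ = 0}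
  zero_mem' σ _ := by simp
  add_mem' {φ ψ} hφ hψ σ hσ := by simp [hφ σ hσ, hψ σ hσ]
  neg_mem' {φ} hφ σ hσ := by simp [hφ σ hσ]

theorem d_mem_vanishing (𝒰 : Set (Set X)) (i j : ℕ) (φ : (cochainFunctor.obj (op X)).X i)
    (hφ : φ ∈ vanishing X 𝒰 i) : (cochainFunctor.obj (op X)).d i j φ ∈ vanishing X 𝒰 j := by
  by_cases hij : (ComplexShape.down ℕ).symm.Rel i j
  · obtain rfl : i + 1 = j := hij
    intro σ hσ
    rw [equivFun_d]
    refine Finset.sum_eq_zero fun k _ => ?_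
    rw [hφ _ (hσ.mono (Set.range_comp_subset_range _ σ)), smul_zero]
  · rw [(cochainFunctor.obj (op X)).shape i j hij]
    exact (vanishing X 𝒰 j).zero_mem

/-- The complex of cochains vanishing on all `𝒰`-small simplices. For `𝒰 = {U}` these are the
cochains of `X` relative to `U`, and for `𝒰 = ∅` all cochains of `X`. -/
def relCochain (X : TopCat.{u}) (𝒰 : Set (Set X)) :
    HomologicalComplex AddCommGrpCat.{u} (ComplexShape.down ℕ).symm :=
  subcomplex (cochainFunctor.obj (op X)) (vanishing X 𝒰) (d_mem_vanishing 𝒰)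

/-- The values of a relative cochain on the singular simplices. -/
def relEval (X : TopCat.{u}) (𝒰 : Set (Set X)) (n : ℕ) :
    (relCochain X 𝒰).X n →+ (C(Simplex n, X) → ULift.{u} ℤ) :=
  (equivFun X n).toAddMonoidHom.comp (vanishing X 𝒰 n).subtype

theorem relEval_injective (n : ℕ) : Function.Injective (relEval X 𝒰 n) :=
  (equivFun X n).injective.comp Subtype.val_injective

theorem relEval_eq_zero {n : ℕ} (φ : (relCochain X 𝒰).X n) {σ : C(Simplex n, X)}
    (hσ : IsSmall 𝒰 (Set.range σ)) : relEval X 𝒰 n φ σ = 0 :=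
  Subtype.prop (p := (· ∈ vanishing X 𝒰 n)) φ σ hσ

theorem exists_relEval_eq {n : ℕ} {F : C(Simplex n, X) → ULift.{u} ℤ}
    (hF : ∀ σ : C(Simplex n, X), IsSmall 𝒰 (Set.range σ) → F σ = 0) :
    ∃ φ, relEval X 𝒰 n φ = F :=
  ⟨⟨(equivFun X n).symm F, fun σ hσ => by rw [AddEquiv.apply_symm_apply, hF σ hσ]⟩,
    (equivFun X n).apply_symm_apply F⟩

theorem relEval_d (n : ℕ) (φ : (relCochain X 𝒰).X n) (σ : C(Simplex (n + 1), X)) :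
    relEval X 𝒰 (n + 1) ((relCochain X 𝒰).d n (n + 1) φ) σ =
      ∑ i : Fin (n + 2), (-1 : ℤ) ^ (i : ℕ) • relEval X 𝒰 n φ (σ.comp (faceMap i)) :=
  equivFun_d X n (Subtype.val (p := (· ∈ vanishing X 𝒰 n)) φ) σ

theorem hom_ext_relEval {K : HomologicalComplex AddCommGrpCat.{u} (ComplexShape.down ℕ).symm}
    {f g : K ⟶ relCochain X 𝒰}
    (h : ∀ n x σ, relEval X 𝒰 n (f.f n x) σ = relEval X 𝒰 n (g.f n x) σ) : f = g := by
  ext n x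
  exact relEval_injective n (funext (h n x))

section Functoriality

/-- A map carrying nonempty small sets to small sets. The empty set is left out because a family
whose only member is `∅` has it as a small set while the empty family has none. -/
def MapsSmall (f : X ⟶ Y) (𝒰 : Set (Set X)) (𝒱 : Set (Set Y)) : Prop :=
  ∀ s, s.Nonempty → IsSmall 𝒰 s → IsSmall 𝒱 (f '' s)

theorem MapsSmall.comp {f : X ⟶ Y} {g : Y ⟶ Z} (hg : MapsSmall g 𝒱 𝒲) (hf : MapsSmall f 𝒰 𝒱) :
    MapsSmall (f ≫ g) 𝒰 𝒲 := fun s hne hs => by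
  simpa only [TopCat.hom_comp, ContinuousMap.coe_comp, Set.image_comp] using
    hg _ (hne.image f) (hf s hne hs)

theorem mapsSmall_id {𝒰 𝒱 : Set (Set X)}
    (h : ∀ s, s.Nonempty → IsSmall 𝒰 s → IsSmall 𝒱 s) : MapsSmall (𝟙 X) 𝒰 𝒱 :=
  fun s hne hs => by simpa using h s hne hs

theorem not_isSmall_empty {α : Type*} (s : Set α) : ¬ IsSmall ∅ s := fun ⟨_, h, _⟩ => h

theorem mapsSmall_empty (f : X ⟶ Y) (𝒱 : Set (Set Y)) : MapsSmall f ∅ 𝒱 :=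
  fun _ _ hs => (not_isSmall_empty _ hs).elim

theorem MapsSmall.isSmall_range {f : X ⟶ Y} (hf : MapsSmall f 𝒰 𝒱) {n : ℕ}
    {σ : C(Simplex n, X)} (hσ : IsSmall 𝒰 (Set.range σ)) :
    IsSmall 𝒱 (Set.range (f.hom.comp σ)) := by
  rw [ContinuousMap.coe_comp, Set.range_comp]
  exact hf _ (Set.range_nonempty σ) hσ

/-- The pullback of relative cochains along a map of pairs. -/
def relMap (f : X ⟶ Y) (hf : MapsSmall f 𝒰 𝒱) : relCochain Y 𝒱 ⟶ relCochain X 𝒰 where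
  f n := AddCommGrpCat.ofHom ((((cochainFunctor.map f.op).f n).hom.comp
    (vanishing Y 𝒱 n).subtype).codRestrict (vanishing X 𝒰 n) fun φ σ hσ =>
      (equivFun_map f n φ σ).trans (φ.2 _ (hf.isSmall_range hσ)))
  comm' i j _ := by
    ext x
    apply Subtype.ext
    exact ConcreteCategory.congr_hom ((cochainFunctor.map f.op).comm i j)
      (x.1 : (cochainFunctor.obj (op Y)).X i)

theorem relEval_relMap (f : X ⟶ Y) (hf : MapsSmall f 𝒰 𝒱) (n : ℕ) (φ : (relCochain Y 𝒱).X n)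
    (σ : C(Simplex n, X)) :
    relEval X 𝒰 n ((relMap f hf).f n φ) σ = relEval Y 𝒱 n φ (f.hom.comp σ) :=
  equivFun_map f n (Subtype.val (p := (· ∈ vanishing Y 𝒱 n)) φ) σ

theorem relMap_comp (f : X ⟶ Y) (g : Y ⟶ Z) (hf : MapsSmall f 𝒰 𝒱) (hg : MapsSmall g 𝒱 𝒲) :
    relMap (f ≫ g) (hg.comp hf) = relMap g hg ≫ relMap f hf :=
  hom_ext_relEval fun n φ σ => (relEval_relMap _ _ n φ σ).trans
    ((relEval_relMap f hf n _ σ).trans (relEval_relMap g hg n φ _)).symm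

theorem relMap_id (h : MapsSmall (𝟙 X) 𝒰 𝒰) : relMap (𝟙 X) h = 𝟙 (relCochain X 𝒰) :=
  hom_ext_relEval fun n φ σ => relEval_relMap (𝟙 X) h n φ σ

/-- Pullback along a homeomorphism matching the small sets is an isomorphism. -/
def relIso (e : X ≅ Y) (h : MapsSmall e.hom 𝒰 𝒱) (h' : MapsSmall e.inv 𝒱 𝒰) :
    relCochain Y 𝒱 ≅ relCochain X 𝒰 where
  hom := relMap e.hom h
  inv := relMap e.inv h'
  hom_inv_id := by
    rw [← relMap_comp]
    simp only [e.inv_hom_id, relMap_id]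
  inv_hom_id := by
    rw [← relMap_comp]
    simp only [e.hom_inv_id, relMap_id]

/-- Without small simplices, relative cochains are arbitrary cochains. -/
def relCochainEmptyIso (X : TopCat.{u}) : relCochain X ∅ ≅ cochainFunctor.obj (op X) :=
  HomologicalComplex.Hom.isoOfComponents
    (fun n => AddEquiv.toAddCommGrpIso (X := AddCommGrpCat.of (vanishing X ∅ n))
      (Y := (cochainFunctor.obj (op X)).X n)
      ⟨⟨Subtype.val, fun φ => ⟨φ, fun _ h => (not_isSmall_empty _ h).elim⟩, fun _ => rfl,
        fun _ => rfl⟩, fun _ _ => rfl⟩)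
    (fun i j _ => by ext; rfl)

theorem relCochainEmptyIso_naturality (f : X ⟶ Y) :
    relMap f (mapsSmall_empty f ∅) ≫ (relCochainEmptyIso X).hom =
      (relCochainEmptyIso Y).hom ≫ cochainFunctor.map f.op := by
  ext n φ
  rfl

end Functoriality

section RestrictionSequence

variable {𝒯 : Set (Set X)}

theorem relMap_f_injective (f : X ⟶ Y) (hf : MapsSmall f 𝒰 𝒱) [IsIso f] (n : ℕ) :
    Function.Injective ((relMap f hf).f n) := fun φ ψ h => by
  refine relEval_injective n (funext fun σ => ?_)
  have hσ := congrArg (relEval X 𝒰 n · ((inv f).hom.comp σ)) h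
  have hcomp : f.hom.comp ((inv f).hom.comp σ) = σ := by
    rw [← ContinuousMap.comp_assoc, ← TopCat.hom_comp, IsIso.inv_hom_id]
    rfl
  simpa only [relEval_relMap, hcomp] using hσ

theorem relMap_f_surjective (j : Y ⟶ X) (hj : Function.Injective j) (hmaps : MapsSmall j 𝒱 𝒰)
    (h𝒱 : ∀ s, IsSmall 𝒰 (j '' s) → IsSmall 𝒱 s) (n : ℕ) :
    Function.Surjective ((relMap j hmaps).f n) := fun ψ => by
  have hcomp : Function.Injective fun τ : C(Simplex n, Y) => j.hom.comp τ := fun τ τ' h =>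
    ContinuousMap.ext fun t => hj (DFunLike.congr_fun h t)
  obtain ⟨φ, hφ⟩ := exists_relEval_eq (𝒰 := 𝒰)
    (F := Function.extend (fun τ => j.hom.comp τ) (relEval Y 𝒱 n ψ) 0) fun σ hσ => by
      by_cases hfac : ∃ τ : C(Simplex n, Y), j.hom.comp τ = σ
      · obtain ⟨τ, rfl⟩ := hfac
        rw [hcomp.extend_apply]
        rw [ContinuousMap.coe_comp, Set.range_comp] at hσ
        exact relEval_eq_zero ψ (h𝒱 _ hσ)
      · exact Function.extend_apply' _ _ _ hfac
  refine ⟨φ, relEval_injective n (funext fun τ => ?_)⟩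
  rw [relEval_relMap, hφ]
  exact hcomp.extend_apply _ _ τ

theorem exists_comp_eq_of_range_subset {j : Y ⟶ X} (hj : Topology.IsEmbedding j) {T : Type*}
    [TopologicalSpace T] {σ : C(T, X)} (hσ : Set.range σ ⊆ Set.range j) :
    ∃ τ : C(T, Y), j.hom.comp τ = σ := by
  choose τ hτ using fun t => hσ ⟨t, rfl⟩
  exact ⟨⟨τ, hj.continuous_iff.2 (σ.continuous.congr fun t => (hτ t).symm)⟩, ContinuousMap.ext hτ⟩

theorem exists_relMap_id_eq (j : Y ⟶ X) (hj : Topology.IsEmbedding j)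
    (h𝒯 : ∀ s, IsSmall 𝒯 s → IsSmall 𝒰 s ∨ s ⊆ Set.range j) (hid : MapsSmall (𝟙 X) 𝒰 𝒯)
    (hmaps : MapsSmall j 𝒱 𝒰) {n : ℕ} {φ : (relCochain X 𝒰).X n}
    (hφ : (relMap j hmaps).f n φ = 0) : ∃ ψ, (relMap (𝟙 X) hid).f n ψ = φ := by
  obtain ⟨ψ, hψ⟩ := exists_relEval_eq (𝒰 := 𝒯) (F := relEval X 𝒰 n φ) fun σ hσ => by
    rcases h𝒯 _ hσ with hsmall | hrange
    · exact relEval_eq_zero φ hsmall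
    · obtain ⟨τ, rfl⟩ := exists_comp_eq_of_range_subset hj hrange
      rw [← relEval_relMap j hmaps, hφ, map_zero, Pi.zero_apply]
  refine ⟨ψ, relEval_injective n (funext fun σ => ?_)⟩
  rw [relEval_relMap, hψ]
  rfl

/-- Restriction along `j : Y ⟶ X` and its kernel, the cochains vanishing in addition on the
simplices in the image of `j`. -/
def restrictionSequence (j : Y ⟶ X)
    (h𝒯 : ∀ s, IsSmall 𝒯 s ↔ IsSmall 𝒰 s ∨ s ⊆ Set.range j)
    (h𝒱 : ∀ s, IsSmall 𝒱 s ↔ IsSmall 𝒰 (j '' s)) :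
    ShortComplex (HomologicalComplex AddCommGrpCat.{u} (ComplexShape.down ℕ).symm) where
  X₁ := relCochain X 𝒯
  X₂ := relCochain X 𝒰
  X₃ := relCochain Y 𝒱
  f := relMap (𝟙 X) (mapsSmall_id fun s _ hs => (h𝒯 s).2 (Or.inl hs))
  g := relMap j fun s _ => (h𝒱 s).1
  zero := hom_ext_relEval fun n φ σ => by
    refine (relEval_relMap j (fun s _ => (h𝒱 s).1) n _ σ).trans
      ((relEval_relMap (𝟙 X) (mapsSmall_id fun s _ hs => (h𝒯 s).2 (Or.inl hs)) n φ _).trans ?_)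
    refine (relEval_eq_zero φ ((h𝒯 _).2 (Or.inr ?_))).trans
      (congrFun (map_zero (relEval Y 𝒱 n)) σ).symm
    exact Set.range_comp_subset_range σ j

theorem restrictionSequence_shortExact (j : Y ⟶ X) (hj : Topology.IsEmbedding j)
    (h𝒯 : ∀ s, IsSmall 𝒯 s ↔ IsSmall 𝒰 s ∨ s ⊆ Set.range j)
    (h𝒱 : ∀ s, IsSmall 𝒱 s ↔ IsSmall 𝒰 (j '' s)) :
    (restrictionSequence j h𝒯 h𝒱).ShortExact := by
  have hid : MapsSmall (𝟙 X) 𝒰 𝒯 := mapsSmall_id fun s _ hs => (h𝒯 s).2 (Or.inl hs)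
  have hmaps : MapsSmall j 𝒱 𝒰 := fun s _ => (h𝒱 s).1
  refine HomologicalComplex.shortExact_of_degreewise_shortExact _ fun n => ?_
  have : Mono ((restrictionSequence j h𝒯 h𝒱).map (HomologicalComplex.eval _ _ n)).f :=
    (AddCommGrpCat.mono_iff_injective _).2 (relMap_f_injective (𝟙 X) hid n)
  have : Epi ((restrictionSequence j h𝒯 h𝒱).map (HomologicalComplex.eval _ _ n)).g :=
    (AddCommGrpCat.epi_iff_surjective _).2
      (relMap_f_surjective j hj.injective hmaps (fun s => (h𝒱 s).2) n)
  exact ⟨(ShortComplex.ab_exact_iff _).2 fun φ hφ =>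
    exists_relMap_id_eq j hj (fun s => (h𝒯 s).1) hid hmaps hφ⟩

end RestrictionSequence

section SmallSimplices

/-- The evaluation of a relative cochain on a chain. -/
def pairing {n : ℕ} (φ : (relCochain X 𝒰).X n) : SingularChain X n →ₗ[ℤ] ULift.{u} ℤ :=
  Finsupp.linearCombination ℤ (relEval X 𝒰 n φ)

theorem pairing_single {n : ℕ} (φ : (relCochain X 𝒰).X n) (σ : C(Simplex n, X)) :
    pairing φ (Finsupp.single σ 1) = relEval X 𝒰 n φ σ :=
  linearCombination_single_one _ _

theorem pairing_d {n : ℕ} (φ : (relCochain X 𝒰).X n) (c : SingularChain X (n + 1)) :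
    pairing ((relCochain X 𝒰).d n (n + 1) φ) c = pairing φ (singularBoundary X n c) := by
  suffices h : pairing ((relCochain X 𝒰).d n (n + 1) φ) =
      pairing φ ∘ₗ singularBoundary X n from LinearMap.congr_fun h c
  refine linearMap_ext_single_one fun σ => ?_
  rw [LinearMap.comp_apply, singularBoundary_single, pairing_single, relEval_d, map_sum]
  simp only [map_zsmul, pairing_single]

theorem pairing_eq_zero {n : ℕ} (φ : (relCochain X 𝒰).X n) {c : SingularChain X n}
    (hc : c ∈ smallChain 𝒰 n) : pairing φ c = 0 := by
  refine (Submodule.mem_bot ℤ).1 (map_mem_of_mem_span (pairing φ) ?_ hc)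
  rintro _ ⟨σ, rfl, hσ⟩
  rw [Submodule.mem_bot, pairing_single, relEval_eq_zero φ hσ]

theorem pairing_iteratedHomotopy_eq {n : ℕ} (φ : (relCochain X 𝒰).X (n + 1))
    {c : SingularChain X n} {M N : ℕ} (hMN : M ≤ N)
    (hc : (singularSubdivision X n ^ M) c ∈ smallChain 𝒰 n) :
    pairing φ (iteratedHomotopy X n N c) = pairing φ (iteratedHomotopy X n M c) := by
  rw [iteratedHomotopy_apply, iteratedHomotopy_apply, map_sum, map_sum]
  refine (Finset.sum_subset (Finset.range_mono hMN) fun j _ hj => ?_).symm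
  refine pairing_eq_zero φ (singularHomotopy_mem_smallChain
    (singularSubdivision_pow_mem_smallChain hc ?_))
  simpa using hj

-- The pairing with `iteratedHomotopy X n N σ` stabilises once the `N`-th subdivision of `σ` is
-- small, so it has a limit even though no single `N` serves all `σ`.
theorem exists_relEval_eq_pairing_iteratedHomotopy (ho : ∀ U ∈ 𝒰, IsOpen U)
    (hc : ⋃₀ 𝒰 = Set.univ) {n : ℕ} (φ : (relCochain X 𝒰).X (n + 1)) :
    ∃ ψ : (relCochain X 𝒰).X n, ∀ (τ : C(Simplex n, X)) (N : ℕ),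
      (singularSubdivision X n ^ N) (Finsupp.single τ 1) ∈ smallChain 𝒰 n →
        relEval X 𝒰 n ψ τ = pairing φ (iteratedHomotopy X n N (Finsupp.single τ 1)) := by
  choose m hm using fun τ : C(Simplex n, X) =>
    exists_singularSubdivision_pow_mem_smallChain ho hc τ
  let F (τ : C(Simplex n, X)) := pairing φ (iteratedHomotopy X n (m τ) (Finsupp.single τ 1))
  have hF (τ : C(Simplex n, X)) (N : ℕ)
      (hN : (singularSubdivision X n ^ N) (Finsupp.single τ 1) ∈ smallChain 𝒰 n) :
      F τ = pairing φ (iteratedHomotopy X n N (Finsupp.single τ 1)) :=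
    (pairing_iteratedHomotopy_eq φ (le_max_left _ N) (hm τ)).symm.trans
      (pairing_iteratedHomotopy_eq φ (le_max_right _ _) hN)
  obtain ⟨ψ, hψ⟩ := exists_relEval_eq (𝒰 := 𝒰) (F := F) fun τ hτ => by
    rw [hF τ 0 (Submodule.subset_span ⟨τ, rfl, hτ⟩), iteratedHomotopy_apply, Finset.range_zero,
      Finset.sum_empty, map_zero]
  exact ⟨ψ, fun τ N hN => (congrFun hψ τ).trans (hF τ N hN)⟩

theorem exists_d_eq (ho : ∀ U ∈ 𝒰, IsOpen U) (hc : ⋃₀ 𝒰 = Set.univ) {n : ℕ}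
    {φ : (relCochain X 𝒰).X (n + 1)} (hφ : (relCochain X 𝒰).d (n + 1) (n + 2) φ = 0) :
    ∃ ψ, (relCochain X 𝒰).d n (n + 1) ψ = φ := by
  obtain ⟨ψ, hψ⟩ := exists_relEval_eq_pairing_iteratedHomotopy ho hc φ
  refine ⟨ψ, relEval_injective _ (funext fun σ => ?_)⟩
  obtain ⟨M, hM⟩ := exists_singularSubdivision_pow_mem_smallChain ho hc σ
  choose m hm using fun i : Fin (n + 2) =>
    exists_singularSubdivision_pow_mem_smallChain ho hc (σ.comp (faceMap i))
  let N := M ⊔ Finset.univ.sup m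
  have hfaces (i : Fin (n + 2)) := hψ (σ.comp (faceMap i)) N <|
    singularSubdivision_pow_mem_smallChain (hm i)
      ((Finset.le_sup (Finset.mem_univ i)).trans le_sup_right)
  have hsmall := pairing_eq_zero φ
    (singularSubdivision_pow_mem_smallChain hM (le_sup_left : M ≤ N))
  have hcocycle (c : SingularChain X (n + 2)) : pairing φ (singularBoundary X (n + 1) c) = 0 := by
    rw [← pairing_d, hφ, pairing, map_zero, Finsupp.linearCombination_zero, LinearMap.zero_apply]
  calc relEval X 𝒰 (n + 1) ((relCochain X 𝒰).d n (n + 1) ψ) σ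
    _ = pairing φ (iteratedHomotopy X n N (singularBoundary X n (Finsupp.single σ 1))) := by
      rw [relEval_d, singularBoundary_single]
      simp only [hfaces, map_sum, map_zsmul]
    _ = pairing φ (Finsupp.single σ 1 - (singularSubdivision X (n + 1) ^ N) (Finsupp.single σ 1) -
          singularBoundary X (n + 1) (iteratedHomotopy X (n + 1) N (Finsupp.single σ 1))) := by
      rw [singularBoundary_iteratedHomotopy, sub_sub_cancel]
    _ = relEval X 𝒰 (n + 1) φ σ := by
      rw [map_sub, map_sub, hsmall, hcocycle, sub_zero, sub_zero, pairing_single]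

theorem eq_zero_of_sUnion_eq_univ (hc : ⋃₀ 𝒰 = Set.univ) (φ : (relCochain X 𝒰).X 0) : φ = 0 := by
  refine relEval_injective 0 (funext fun σ => ?_)
  obtain ⟨U, hU, hx⟩ := Set.mem_sUnion.1 (hc ▸ Set.mem_univ (σ default))
  rw [map_zero]
  refine relEval_eq_zero φ ⟨U, hU, ?_⟩
  rintro _ ⟨t, rfl⟩
  rwa [Subsingleton.elim t default]

theorem relCochain_acyclic (ho : ∀ U ∈ 𝒰, IsOpen U) (hc : ⋃₀ 𝒰 = Set.univ) :
    (relCochain X 𝒰).Acyclic := by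
  rintro (_ | n)
  · rw [HomologicalComplex.exactAt_iff, ShortComplex.ab_exact_iff]
    exact fun φ _ => ⟨0, (map_zero _).trans (eq_zero_of_sUnion_eq_univ hc φ).symm⟩
  · rw [HomologicalComplex.exactAt_iff' _ n (n + 1) (n + 2) (ComplexShape.prev_eq' _ rfl)
      (ComplexShape.next_eq' _ rfl), ShortComplex.ab_exact_iff]
    exact fun φ hφ => exists_d_eq ho hc hφ

end SmallSimplices

end SingularCochain

/-! ### Long exact sequences -/

namespace LongExactSequence

open CategoryTheory HomologicalComplex HomologicalComplex.HomologySequence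

variable {C ι : Type*} [Category* C] [Abelian C] {c : ComplexShape ι}
  {S S₁ S₂ : ShortComplex (HomologicalComplex C c)}

theorem isIso_homologyMap_τ₁_of_rel (φ : S₁ ⟶ S₂) (hS₁ : S₁.ShortExact) (hS₂ : S₂.ShortExact)
    {i j : ι} (hij : c.Rel i j) [Epi (homologyMap φ.τ₂ i)] [IsIso (homologyMap φ.τ₃ i)]
    [IsIso (homologyMap φ.τ₂ j)] [Mono (homologyMap φ.τ₃ j)] : IsIso (homologyMap φ.τ₁ j) :=
  Abelian.isIso_of_epi_of_isIso_of_isIso_of_mono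
    (composableArrows₅_exact hS₁ i j hij).δ₀ (composableArrows₅_exact hS₂ i j hij).δ₀
    (ComposableArrows.δ₀Functor.map (mapComposableArrows₅ φ hS₁ hS₂ i j hij))
    ‹Epi (homologyMap φ.τ₂ i)› ‹IsIso (homologyMap φ.τ₃ i)› ‹IsIso (homologyMap φ.τ₂ j)›
    ‹Mono (homologyMap φ.τ₃ j)›

theorem isIso_τ₁_of_exact {T₁ T₂ : ShortComplex C} (φ : T₁ ⟶ T₂) (hT₁ : T₁.Exact) [Mono T₁.f]
    [Mono T₂.f] [IsIso φ.τ₂] [Mono φ.τ₃] : IsIso φ.τ₁ := by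
  have hzero : (T₂.f ≫ inv φ.τ₂) ≫ T₁.g = 0 := by
    rw [← cancel_mono φ.τ₃, Category.assoc, Category.assoc, ← φ.comm₂₃, IsIso.inv_hom_id_assoc,
      T₂.zero, Limits.zero_comp]
  refine ⟨hT₁.lift _ hzero, ?_, ?_⟩
  · rw [← cancel_mono T₁.f, Category.assoc, hT₁.lift_f, φ.comm₁₂_assoc, IsIso.hom_inv_id,
      Category.comp_id, Category.id_comp]
  · rw [← cancel_mono T₂.f, Category.assoc, φ.comm₁₂, hT₁.lift_f_assoc, Category.assoc,
      IsIso.inv_hom_id, Category.comp_id, Category.id_comp]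

theorem isIso_homologyMap_τ₁_of_not_rel (φ : S₁ ⟶ S₂) (hS₁ : S₁.ShortExact)
    (hS₂ : S₂.ShortExact) {j : ι} (hj : ∀ i, ¬ c.Rel i j) [hτ₂ : IsIso (homologyMap φ.τ₂ j)]
    [hτ₃ : Mono (homologyMap φ.τ₃ j)] : IsIso (homologyMap φ.τ₁ j) := by
  have := hS₁.mono_f
  have := hS₂.mono_f
  let ψ := (homologyFunctor C c j).mapShortComplex.map φ
  have : Mono ((homologyFunctor C c j).mapShortComplex.obj S₁).f :=
    mono_homologyMap_of_mono_of_not_rel S₁.f j hj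
  have : Mono ((homologyFunctor C c j).mapShortComplex.obj S₂).f :=
    mono_homologyMap_of_mono_of_not_rel S₂.f j hj
  have : IsIso ψ.τ₂ := hτ₂
  have : Mono ψ.τ₃ := hτ₃
  exact isIso_τ₁_of_exact ψ (hS₁.homology_exact₂ j)

theorem quasiIso_τ₁ (φ : S₁ ⟶ S₂) (hS₁ : S₁.ShortExact) (hS₂ : S₂.ShortExact)
    [QuasiIso φ.τ₂] [QuasiIso φ.τ₃] : QuasiIso φ.τ₁ := by
  refine (quasiIso_iff _).2 fun j => (quasiIsoAt_iff_isIso_homologyMap _ _).2 ?_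
  by_cases! hj : ∃ i, c.Rel i j
  · obtain ⟨i, hij⟩ := hj
    exact isIso_homologyMap_τ₁_of_rel φ hS₁ hS₂ hij
  · exact isIso_homologyMap_τ₁_of_not_rel φ hS₁ hS₂ hj

theorem quasiIso_g_of_acyclic (hS : S.ShortExact) (h : S.X₁.Acyclic) : QuasiIso S.g := by
  refine (quasiIso_iff _).2 fun i => (quasiIsoAt_iff_isIso_homologyMap _ _).2 ?_
  have : Mono (homologyMap S.g i) :=
    (hS.homology_exact₂ i).mono_g ((h i).isZero_homology.eq_of_src _ _)
  have : Epi (homologyMap S.g i) := by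
    by_cases! hi : ∃ j, c.Rel i j
    · obtain ⟨j, hij⟩ := hi
      exact (hS.homology_exact₃ i j hij).epi_f ((h j).isZero_homology.eq_of_tgt _ _)
    · have := hS.epi_g
      exact epi_homologyMap_of_epi_of_not_rel S.g i hi
  exact isIso_of_mono_of_epi _

theorem isZero_homology_X₁_of_not_rel (hS : S.ShortExact) {j : ι} (hj : ∀ i, ¬ c.Rel i j)
    (h : Limits.IsZero (S.X₂.homology j)) : Limits.IsZero (S.X₁.homology j) := by
  have := hS.mono_f
  have := mono_homologyMap_of_mono_of_not_rel S.f j hj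
  exact Limits.IsZero.of_mono (homologyMap S.f j) h

theorem shortExact_homologyMap_g_δ (hS : S.ShortExact) {i j : ι} (hij : c.Rel i j)
    (hi : homologyMap S.f i = 0) (hj : homologyMap S.f j = 0) :
    (ShortComplex.mk (homologyMap S.g i) (hS.δ i j hij) (hS.comp_δ i j hij)).ShortExact where
  exact := hS.homology_exact₃ i j hij
  mono_f := (hS.homology_exact₂ i).mono_g hi
  epi_g := (hS.homology_exact₁ i j hij).epi_f hj

end LongExactSequence

/-! ### Excision and the Thom isomorphism -/

namespace SingularCochain

open CategoryTheory Opposite Module SimplexSubdivision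

section Pairs

variable {X Y : TopCat.{u}}

theorem isSmall_singleton {α : Type*} {U s : Set α} : IsSmall {U} s ↔ s ⊆ U := by
  simp [IsSmall]

theorem isSmall_pair {α : Type*} {U V s : Set α} : IsSmall {U, V} s ↔ s ⊆ U ∨ s ⊆ V := by
  simp [IsSmall]

theorem mapsSmall_singleton {f : X ⟶ Y} {U : Set X} {V : Set Y} (h : Set.MapsTo f U V) :
    MapsSmall f {U} {V} := fun s _ hs => by
  rw [isSmall_singleton] at hs ⊢
  exact (Set.image_mono hs).trans h.image_subset

/-- The sequence of relative, absolute and restricted cochains of the pair `(X, U)`, where `U` is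
the image of `j : Y ⟶ X`. -/
abbrev pairSequence (j : Y ⟶ X) {U : Set X} (hU : Set.range j = U) :
    ShortComplex (HomologicalComplex AddCommGrpCat.{u} (ComplexShape.down ℕ).symm) :=
  restrictionSequence j (𝒯 := {U}) (𝒰 := ∅) (𝒱 := ∅)
    (fun s => by simp [isSmall_singleton, hU, not_isSmall_empty])
    (fun s => by simp [not_isSmall_empty])

theorem pairSequence_shortExact (j : Y ⟶ X) (hj : Topology.IsEmbedding j) {U : Set X}
    (hU : Set.range j = U) : (pairSequence j hU).ShortExact :=
  restrictionSequence_shortExact j hj _ _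

instance quasiIso_relMap_empty (f : X ⟶ Y) [QuasiIso (cochainFunctor.map f.op)] :
    QuasiIso (relMap f (mapsSmall_empty f ∅)) := by
  have : relMap f (mapsSmall_empty f ∅) = (relCochainEmptyIso Y).hom ≫
      cochainFunctor.map f.op ≫ (relCochainEmptyIso X).inv := by
    rw [← Category.assoc, ← relCochainEmptyIso_naturality, Category.assoc, Iso.hom_inv_id,
      Category.comp_id]
  rw [this]
  infer_instance

theorem relCochain_acyclic_of_quasiIso (j : Y ⟶ X) (hj : Topology.IsEmbedding j) {U : Set X}
    (hU : Set.range j = U) [QuasiIso (cochainFunctor.map j.op)] : (relCochain X {U}).Acyclic :=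
  (pairSequence_shortExact j hj hU).acyclic_X₁ (quasiIso_relMap_empty j)

theorem relMap_comp_eq {Z W : TopCat.{u}} {𝒰 : Set (Set X)} {𝒱 : Set (Set Y)} {𝒲 : Set (Set Z)}
    {𝒯 : Set (Set W)} {f : X ⟶ Y} {g : Y ⟶ W} {f' : X ⟶ Z} {g' : Z ⟶ W} (w : f ≫ g = f' ≫ g')
    (hf : MapsSmall f 𝒰 𝒱) (hg : MapsSmall g 𝒱 𝒯) (hf' : MapsSmall f' 𝒰 𝒲)
    (hg' : MapsSmall g' 𝒲 𝒯) : relMap g hg ≫ relMap f hf = relMap g' hg' ≫ relMap f' hf' := by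
  rw [← relMap_comp, ← relMap_comp]
  simp only [w]

theorem quasiIso_relMap {A B : TopCat.{u}} {i : A ⟶ X} (hi : Topology.IsEmbedding i) {j : B ⟶ Y}
    (hj : Topology.IsEmbedding j) {f : X ⟶ Y} (g : A ⟶ B) (w : i ≫ f = g ≫ j) {U : Set X}
    {V : Set Y} (hU : Set.range i = U) (hV : Set.range j = V) (hUV : MapsSmall f {U} {V})
    [QuasiIso (cochainFunctor.map f.op)] [QuasiIso (cochainFunctor.map g.op)] :
    QuasiIso (relMap f hUV) := by
  let φ : pairSequence j hV ⟶ pairSequence i hU :=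
    { τ₁ := relMap f hUV
      τ₂ := relMap f (mapsSmall_empty f ∅)
      τ₃ := relMap g (mapsSmall_empty g ∅)
      comm₁₂ := relMap_comp_eq (by rw [Category.id_comp, Category.comp_id])
        (mapsSmall_empty _ _) hUV (mapsSmall_empty _ _) (mapsSmall_empty _ _)
      comm₂₃ := relMap_comp_eq w (mapsSmall_empty _ _) (mapsSmall_empty _ _)
        (mapsSmall_empty _ _) (mapsSmall_empty _ _) }
  have : QuasiIso φ.τ₂ := quasiIso_relMap_empty f
  have : QuasiIso φ.τ₃ := quasiIso_relMap_empty g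
  exact LongExactSequence.quasiIso_τ₁ φ (pairSequence_shortExact j hj hV)
    (pairSequence_shortExact i hi hU)

-- The kernel of the restriction consists of the cochains vanishing on the simplices which are
-- small for the open cover by `U` and the image of `j`.
theorem quasiIso_relMap_of_isOpenEmbedding (j : Y ⟶ X) (hj : Topology.IsOpenEmbedding j)
    {U : Set X} (hU : IsOpen U) (hcover : U ∪ Set.range j = Set.univ) {V : Set Y}
    (hV : j ⁻¹' U = V) : QuasiIso (relMap j (mapsSmall_singleton (U := V) hV.superset)) := by
  have hS := restrictionSequence_shortExact j hj.isEmbedding (𝒯 := {U, Set.range j}) (𝒰 := {U})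
    (𝒱 := {V}) (fun s => by rw [isSmall_pair, isSmall_singleton])
    (fun s => by rw [isSmall_singleton, isSmall_singleton, Set.image_subset_iff, hV])
  refine LongExactSequence.quasiIso_g_of_acyclic hS (relCochain_acyclic ?_ ?_)
  · rintro W (rfl | rfl)
    exacts [hU, hj.isOpen_range]
  · rwa [Set.sUnion_pair]

end Pairs

section Contractible

open AlgebraicTopology

theorem cochainFunctor_exactAt_of_totallyDisconnectedSpace (X : TopCat.{u})
    [TotallyDisconnectedSpace X] (n : ℕ) : (cochainFunctor.obj (op X)).ExactAt (n + 1) := by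
  let e := (HomotopyEquiv.ofIso (singularChainComplexFunctorIsoOfTotallyDisconnectedSpace
    AddCommGrpCat.{u} (AddCommGrpCat.of (ULift.{u} ℤ)) X)).trans
      (ChainComplex.alternatingConstHomotopyEquiv _)
  have hsingle : (dualFunctor.obj (op ((ChainComplex.single₀ _).obj
      (∐ fun _ : X => AddCommGrpCat.of (ULift.{u} ℤ))))).ExactAt (n + 1) :=
    ShortComplex.exact_of_isZero_X₂ _ ((preadditiveYoneda.obj _).map_isZero
      (HomologicalComplex.isZero_single_obj_X _ _ _ _ n.succ_ne_zero).op)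
  rw [HomologicalComplex.exactAt_iff_isZero_homology, Limits.IsZero.iff_id_eq_zero]
  have inv_eq_zero : HomologicalComplex.homologyMap (dualFunctor.map e.inv.op) (n + 1) = 0 :=
    hsingle.isZero_homology.eq_of_tgt _ 0
  calc 𝟙 _ = HomologicalComplex.homologyMap (dualFunctor.map (𝟙 (chainFunctor.obj X)).op) _ := by
        rw [op_id, CategoryTheory.Functor.map_id, HomologicalComplex.homologyMap_id]
    _ = HomologicalComplex.homologyMap (dualFunctor.map (e.hom ≫ e.inv).op) _ :=
      (homologyMap_dualFunctor_eq_of_homotopy e.homotopyHomInvId _).symm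
    _ = 0 := by
      rw [op_comp, Functor.map_comp, HomologicalComplex.homologyMap_comp, inv_eq_zero,
        Limits.zero_comp]

end Contractible

/-- The homology of `K` is that of `L` shifted up by `k` degrees. -/
def IsHomologyShift (k : ℕ)
    (K L : HomologicalComplex AddCommGrpCat.{u} (ComplexShape.down ℕ).symm) : Prop :=
  (∀ n < k, Limits.IsZero (K.homology n)) ∧
    ∀ n m, n + k = m → Nonempty (K.homology m ≅ L.homology n)

namespace IsHomologyShift

variable {K L M : HomologicalComplex AddCommGrpCat.{u} (ComplexShape.down ℕ).symm}

theorem of_homologyIso (e : ∀ n, K.homology n ≅ L.homology n) : IsHomologyShift 0 K L :=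
  ⟨fun n hn => absurd hn n.not_lt_zero, fun n m hm => ⟨eqToIso (by subst hm; rfl) ≪≫ e n⟩⟩

theorem of_quasiIso (f : K ⟶ L) [QuasiIso f] : IsHomologyShift 0 K L :=
  of_homologyIso fun n => isoOfQuasiIsoAt f n

theorem of_quasiIso_symm (f : K ⟶ L) [QuasiIso f] : IsHomologyShift 0 L K :=
  of_homologyIso fun n => (isoOfQuasiIsoAt f n).symm

theorem trans {k l m : ℕ} (h : IsHomologyShift k K L) (h' : IsHomologyShift l L M)
    (hm : l + k = m) : IsHomologyShift m K M := by
  refine ⟨fun n hn => ?_, fun n i hi =>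
    ⟨(h.2 (n + l) i (by lia)).some ≪≫ (h'.2 n _ rfl).some⟩⟩
  obtain hnk | hkn := lt_or_ge n k
  · exact h.1 n hnk
  · exact (h'.1 (n - k) (by lia)).of_iso (h.2 (n - k) n (by lia)).some

theorem of_shortExact
    {S : ShortComplex (HomologicalComplex AddCommGrpCat.{u} (ComplexShape.down ℕ).symm)}
    (hS : S.ShortExact) (h : S.X₂.Acyclic) : IsHomologyShift 1 S.X₁ S.X₃ := by
  refine ⟨fun n hn => ?_, fun n m hnm => ⟨(hS.δIso n m hnm (h n).isZero_homology
    (h m).isZero_homology).symm⟩⟩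
  obtain rfl := Nat.lt_one_iff.1 hn
  exact LongExactSequence.isZero_homology_X₁_of_not_rel hS (fun i => i.succ_ne_zero)
    (h 0).isZero_homology

end IsHomologyShift

/-- The inclusion of a subspace. -/
abbrev inclusion {W : TopCat.{u}} (U : Set W) : TopCat.of U ⟶ W :=
  TopCat.ofHom ⟨Subtype.val, continuous_subtype_val⟩

theorem isEmbedding_inclusion {W : TopCat.{u}} (U : Set W) :
    Topology.IsEmbedding (inclusion U) :=
  Topology.IsEmbedding.subtypeVal

theorem range_inclusion {W : TopCat.{u}} (U : Set W) : Set.range (inclusion U) = U :=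
  Subtype.range_coe

section ProductPairs

variable {W : TopCat.{u}} {E : Type} [TopologicalSpace E]

variable (W E) in
/-- The projection `W × E ⟶ W`. -/
abbrev fst : TopCat.of (W × E) ⟶ W := TopCat.ofHom ContinuousMap.fst

/-- The subspace `O × E ∪ W × s` of `W × E`, so that the product of the pairs `(W, O)` and `(E, s)`
is the pair `(W × E, prodUnion O s)`. -/
def prodUnion (O : Set W) (s : Set E) : Set (TopCat.of (W × E)) := fst W E ⁻¹' O ∪ Prod.snd ⁻¹' s

variable (O : Set W) {s t : Set E}

theorem prodUnion_mono (h : s ⊆ t) : prodUnion O s ⊆ prodUnion O t :=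
  Set.union_subset_union_right _ (Set.preimage_mono h)

theorem prodUnion_union : prodUnion O (s ∪ t) = prodUnion O s ∪ prodUnion O t := by
  rw [prodUnion, Set.preimage_union, Set.union_union_distrib_left]
  rfl

theorem prodUnion_inter_of_disjoint (h : Disjoint s t) :
    prodUnion O s ∩ prodUnion O t = fst W E ⁻¹' O := by
  rw [prodUnion, prodUnion, ← Set.union_inter_distrib_left, ← Set.preimage_inter,
    h.inter_eq, Set.preimage_empty, Set.union_empty]

theorem isOpen_prodUnion {O : Set W} (hO : IsOpen O) (hs : IsOpen s) : IsOpen (prodUnion O s) :=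
  (hO.preimage continuous_fst).union (hs.preimage continuous_snd)

variable [AddCommGroup E] [Module ℝ E] [ContinuousSMul ℝ E]

variable (W E) in
theorem quasiIso_map_fst : QuasiIso (cochainFunctor.map (fst W E).op) := by
  refine quasiIso_map_of_homotopyEquiv _ (TopCat.ofHom ⟨fun w => (w, 0), by fun_prop⟩)
    ⟨⟨fun p => (p.2.1, (p.1 : ℝ) • p.2.2), by fun_prop⟩, ?_, ?_⟩ (TopCat.Homotopy.refl _)
  · rintro ⟨w, x⟩
    simp
  · rintro ⟨w, x⟩
    simp

variable [ContinuousAdd E]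

theorem quasiIso_map_inclusion_comp_fst {S : Set (TopCat.of (W × E))} {c : E}
    (hS : ∀ w, StarConvex ℝ c (Prod.mk w ⁻¹' S)) (hc : ∀ w, (w, c) ∈ S) :
    QuasiIso (cochainFunctor.map (inclusion S ≫ fst W E).op) := by
  let level : W ⟶ TopCat.of S := TopCat.ofHom ⟨fun w => ⟨(w, c), hc w⟩, by fun_prop⟩
  have mem (p : unitInterval × S) : (p.2.1.1, (1 - (p.1 : ℝ)) • c + (p.1 : ℝ) • p.2.1.2) ∈ S :=
    hS _ p.2.2 (sub_nonneg.2 p.1.2.2) p.1.2.1 (sub_add_cancel _ _)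
  refine quasiIso_map_of_homotopyEquiv _ level
    ⟨⟨fun p => ⟨_, mem p⟩, Continuous.subtype_mk (by fun_prop) _⟩, fun p => Subtype.ext ?_,
      fun p => Subtype.ext ?_⟩ (TopCat.Homotopy.refl _)
  · simp [level]
  · simp

theorem quasiIso_map_inclusion_prodUnion_comp_fst {c : E} (hs : StarConvex ℝ c s) (hc : c ∈ s) :
    QuasiIso (cochainFunctor.map
      (inclusion (prodUnion O s) ≫ fst W E).op) :=
  quasiIso_map_inclusion_comp_fst (fun _ _ hx _ _ ha hb hab => hx.imp id fun h => hs h ha hb hab)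
    fun _ => Or.inr hc

theorem relCochain_prodUnion_acyclic {c : E} (hs : StarConvex ℝ c s) (hc : c ∈ s) :
    (relCochain (TopCat.of (W × E)) {prodUnion O s}).Acyclic := by
  have := quasiIso_map_fst W E
  have hcomp := quasiIso_map_inclusion_prodUnion_comp_fst O hs hc
  rw [op_comp, Functor.map_comp] at hcomp
  have := quasiIso_of_comp_left (cochainFunctor.map (fst W E).op)
    (cochainFunctor.map (inclusion (prodUnion O s)).op)
  exact relCochain_acyclic_of_quasiIso _ (isEmbedding_inclusion _) (range_inclusion _)

theorem quasiIso_relMap_inclusion_prodUnion_comp_fst {c : E} (hs : StarConvex ℝ c s) (hc : c ∈ s) :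
    QuasiIso (relMap (inclusion (prodUnion O s) ≫ fst W E)
      (mapsSmall_singleton (Set.mapsTo_preimage _ O))) := by
  have := quasiIso_map_inclusion_prodUnion_comp_fst O hs hc
  have := quasiIso_map_fst (TopCat.of O) E
  let i : TopCat.of (O × E) ⟶ TopCat.of (prodUnion O s) :=
    TopCat.ofHom ⟨fun p => ⟨(p.1, p.2), Or.inl p.1.2⟩, by fun_prop⟩
  have hi : Topology.IsEmbedding i :=
    Topology.IsEmbedding.of_comp i.hom.continuous continuous_subtype_val
      (Topology.IsEmbedding.subtypeVal.prodMap Topology.IsEmbedding.id)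
  have range_i :
      Set.range i = (inclusion (prodUnion O s) ≫ fst W E) ⁻¹' O :=
    Set.ext fun p => ⟨by rintro ⟨q, rfl⟩; exact q.1.2, fun hp => ⟨(⟨p.1.1, hp⟩, p.1.2), rfl⟩⟩
  exact quasiIso_relMap hi (isEmbedding_inclusion O) (fst (TopCat.of O) E) rfl range_i
    (range_inclusion O) _

end ProductPairs

section Suspension

open Set

variable {W : TopCat.{u}} {O : Set W}

variable (O) in
theorem prodUnion_Iio_subset : prodUnion O (Iio (0 : ℝ)) ⊆ prodUnion O {0}ᶜ :=
  prodUnion_mono O fun _ hx => ne_of_lt hx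

variable (O) in
theorem prodUnion_Ioi_subset : prodUnion O (Ioi (0 : ℝ)) ⊆ prodUnion O {0}ᶜ :=
  prodUnion_mono O fun _ hx => ne_of_gt hx

theorem isHomologyShift_inclusion_preimage_prodUnion (hO : IsOpen O) :
    IsHomologyShift 0
      (relCochain (TopCat.of (prodUnion O ({0}ᶜ : Set ℝ)))
        {inclusion (prodUnion O {0}ᶜ) ⁻¹' prodUnion O (Ioi 0)})
      (relCochain W {O}) := by
  let j := inclusion (prodUnion O ({0}ᶜ : Set ℝ))
  let k : TopCat.of (prodUnion O (Iio (0 : ℝ))) ⟶ TopCat.of (prodUnion O ({0}ᶜ : Set ℝ)) :=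
    TopCat.ofHom ⟨Set.inclusion (prodUnion_Iio_subset O), continuous_inclusion _⟩
  have hk : Topology.IsOpenEmbedding k := .of_comp k
    (isOpen_prodUnion hO isOpen_compl_singleton).isOpenEmbedding_subtypeVal
    (isOpen_prodUnion hO isOpen_Iio).isOpenEmbedding_subtypeVal
  have hU : IsOpen (j ⁻¹' prodUnion O (Ioi 0)) :=
    (isOpen_prodUnion hO isOpen_Ioi).preimage j.hom.continuous
  have hcover : j ⁻¹' prodUnion O (Ioi 0) ∪ range k = univ := by
    have range_k : range k = j ⁻¹' prodUnion O (Iio 0) :=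
      Set.range_inclusion (prodUnion_Iio_subset O)
    rw [range_k, ← preimage_union, ← prodUnion_union, union_comm, Iio_union_Ioi]
    exact Subtype.coe_preimage_self _
  have hpreimage : k ⁻¹' (j ⁻¹' prodUnion O (Ioi 0)) =
      (inclusion (prodUnion O (Iio (0 : ℝ))) ≫ fst W ℝ) ⁻¹' O := by
    change inclusion _ ⁻¹' (prodUnion O (Ioi 0)) = inclusion _ ⁻¹' (fst W ℝ ⁻¹' O)
    rw [← prodUnion_inter_of_disjoint O (Iio_disjoint_Ioi_same)]
    exact (Subtype.preimage_coe_self_inter _ _).symm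
  have excision := quasiIso_relMap_of_isOpenEmbedding k hk hU hcover hpreimage
  have projection := quasiIso_relMap_inclusion_prodUnion_comp_fst O
    ((convex_Iio (0 : ℝ)).starConvex (x := -1) (by simp)) (by simp)
  exact (IsHomologyShift.of_quasiIso (relMap k (mapsSmall_singleton hpreimage.superset))).trans
    (IsHomologyShift.of_quasiIso_symm (relMap (inclusion _ ≫ fst W ℝ) (mapsSmall_singleton
      (Set.mapsTo_preimage _ O)))) (zero_add 0)

theorem isHomologyShift_prodUnion_compl_zero_real (hO : IsOpen O) :
    IsHomologyShift 1 (relCochain (TopCat.of (W × ℝ)) {prodUnion O {0}ᶜ}) (relCochain W {O}) := by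
  have hS := restrictionSequence_shortExact (inclusion (prodUnion O ({0}ᶜ : Set ℝ)))
    (isEmbedding_inclusion _) (𝒯 := {prodUnion O {0}ᶜ}) (𝒰 := {prodUnion O (Ioi 0)})
    (𝒱 := {inclusion _ ⁻¹' prodUnion O (Ioi 0)})
    (fun s => by
      rw [isSmall_singleton, isSmall_singleton, range_inclusion, or_iff_right_of_imp]
      exact fun h => h.trans (prodUnion_Ioi_subset O))
    (fun s => by rw [isSmall_singleton, isSmall_singleton, image_subset_iff])
  have acyclic : (relCochain (TopCat.of (W × ℝ)) {prodUnion O (Ioi (0 : ℝ))}).Acyclic :=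
    relCochain_prodUnion_acyclic O ((convex_Ioi 0).starConvex (mem_Ioi.2 one_pos))
      (mem_Ioi.2 one_pos)
  exact (IsHomologyShift.of_shortExact hS acyclic).trans
    (isHomologyShift_inclusion_preimage_prodUnion hO) (zero_add 1)

end Suspension

theorem isHomologyShift_zero_empty (Y : TopCat.{u}) :
    IsHomologyShift 0 (relCochain Y {∅}) (cochainFunctor.obj (op Y)) :=
  .of_quasiIso ((relIso (Iso.refl Y) (mapsSmall_empty _ _) fun _ hs h =>
    absurd (isSmall_singleton.1 h) hs.not_subset_empty).hom ≫ (relCochainEmptyIso Y).hom)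

theorem isHomologyShift_of_homeomorph {X Y : TopCat.{u}} (e : X ≃ₜ Y) {U : Set X} {V : Set Y}
    (h : ∀ x, e x ∈ V ↔ x ∈ U) : IsHomologyShift 0 (relCochain X {U}) (relCochain Y {V}) :=
  .of_quasiIso (relIso (TopCat.isoOfHomeo e) (mapsSmall_singleton fun x => (h x).2)
    (mapsSmall_singleton fun y hy => (h _).1 (by rwa [← e.apply_symm_apply y] at hy))).inv

theorem isHomologyShift_of_common_neighbourhood {N X Y : TopCat.{u}} {i : N ⟶ X} {j : N ⟶ Y}
    (hi : Topology.IsOpenEmbedding i) (hj : Topology.IsOpenEmbedding j) {U : Set X} {V : Set Y}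
    (hU : IsOpen U) (hV : IsOpen V) (hiU : U ∪ Set.range i = Set.univ)
    (hjV : V ∪ Set.range j = Set.univ) (h : i ⁻¹' U = j ⁻¹' V) :
    IsHomologyShift 0 (relCochain X {U}) (relCochain Y {V}) := by
  have := quasiIso_relMap_of_isOpenEmbedding i hi hU hiU rfl
  have := quasiIso_relMap_of_isOpenEmbedding j hj hV hjV h.symm
  exact (IsHomologyShift.of_quasiIso
    (relMap i (mapsSmall_singleton (Set.mapsTo_preimage i U)))).trans
    (.of_quasiIso_symm (relMap j (mapsSmall_singleton h.subset))) rfl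

section TubularNeighbourhood

variable {E : Type} [AddCommGroup E] [Module ℝ E] [TopologicalSpace E] [IsTopologicalAddGroup E]
  [ContinuousSMul ℝ E] [T2Space E] [FiniteDimensional ℝ E]

theorem isHomologyShift_prodUnion_compl_zero {W : TopCat.{u}} {O : Set W} (hO : IsOpen O) :
    IsHomologyShift (finrank ℝ E) (relCochain (TopCat.of (W × E)) {prodUnion O {0}ᶜ})
      (relCochain W {O}) := by
  induction hn : finrank ℝ E generalizing E with
  | zero =>
    have := finrank_zero_iff.1 hn
    have : Unique E := ⟨⟨0⟩, fun x => Subsingleton.elim _ _⟩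
    exact isHomologyShift_of_homeomorph (X := TopCat.of (W × E)) (Homeomorph.prodUnique W E)
      fun x => (or_iff_left fun h => h (Subsingleton.elim x.2 0)).symm
  | succ n ih =>
    let F := Fin n → ℝ
    let e : E ≃L[ℝ] F × ℝ := .ofFinrankEq (by simp [F, hn])
    let W' := TopCat.of (W × F)
    let O' : Set W' := prodUnion O {0}ᶜ
    have mem_iff (x : W × E) : (x.1 ∈ O ∨ (e x.2).1 ≠ 0) ∨ (e x.2).2 ≠ 0 ↔ x.1 ∈ O ∨ x.2 ≠ 0 := by
      have hzero : x.2 = 0 ↔ (e x.2).1 = 0 ∧ (e x.2).2 = 0 := by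
        rw [← e.map_eq_zero_iff, Prod.ext_iff]
        rfl
      rw [ne_eq x.2, hzero, not_and_or, or_assoc]
    have split : IsHomologyShift 0 (relCochain (TopCat.of (W × E)) {prodUnion O {0}ᶜ})
        (relCochain (TopCat.of (W' × ℝ)) {prodUnion O' {0}ᶜ}) :=
      isHomologyShift_of_homeomorph (X := TopCat.of (W × E)) (Y := TopCat.of (W' × ℝ))
        (((Homeomorph.refl W).prodCongr e.toHomeomorph).trans
          (Homeomorph.prodAssoc W F ℝ).symm) mem_iff
    have hO' : IsOpen O' := isOpen_prodUnion hO isOpen_compl_singleton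
    have line := isHomologyShift_prodUnion_compl_zero_real hO'
    have fibre := ih (E := F) (by simp [F])
    exact (split.trans line rfl).trans fibre rfl

variable {X : TopCat.{u}} {B : Type u} [TopologicalSpace B] {i : X → B × E} {Y : Set B}
  {U : Set X}

/-- Both pairs are compared by excision with the tube, the part of `X` lying over `Y`. -/
theorem isHomologyShift_finrank_of_isOpenEmbedding (hi : Topology.IsOpenEmbedding i)
    (hY : ∀ b, (b, 0) ∈ Set.range i ↔ b ∈ Y) (hU : ∀ x, x ∈ U ↔ (i x).2 ≠ 0) :
    IsHomologyShift (finrank ℝ E) (relCochain X {U}) (cochainFunctor.obj (op (TopCat.of Y))) := by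
  have hYo : IsOpen Y := by
    have : Y = (fun b => (b, 0)) ⁻¹' Set.range i := Set.ext fun b => (hY b).symm
    exact this ▸ hi.isOpen_range.preimage (by fun_prop)
  have hUo : IsOpen U := by
    have : U = (fun x => (i x).2) ⁻¹' {0}ᶜ := Set.ext hU
    exact this ▸ isOpen_compl_singleton.preimage (continuous_snd.comp hi.continuous)
  have base_mem {x : X} (hx : x ∉ U) : (i x).1 ∈ Y :=
    (hY _).1 ⟨x, Prod.ext rfl (not_not.1 (mt (hU x).2 hx))⟩
  let T : Set X := (fun x => (i x).1) ⁻¹' Y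
  have hT : IsOpen T := hYo.preimage (continuous_fst.comp hi.continuous)
  let W := TopCat.of Y
  let j : TopCat.of T ⟶ TopCat.of (W × E) := TopCat.ofHom
    ⟨fun x => (⟨(i x).1, x.2⟩, (i x).2), by have := hi.continuous; fun_prop⟩
  have hj : Topology.IsOpenEmbedding j := .of_comp (g := Prod.map (Subtype.val : Y → B) id) j
    (hYo.isOpenEmbedding_subtypeVal.prodMap .id) (hi.comp hT.isOpenEmbedding_subtypeVal)
  have excision : IsHomologyShift 0 (relCochain X {U})
      (relCochain (TopCat.of (W × E)) {prodUnion ∅ {0}ᶜ}) := by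
    refine isHomologyShift_of_common_neighbourhood (i := inclusion T)
      hT.isOpenEmbedding_subtypeVal hj hUo (isOpen_prodUnion isOpen_empty isOpen_compl_singleton)
      (Set.eq_univ_of_forall fun x => or_iff_not_imp_left.2 fun hx => ⟨⟨x, base_mem hx⟩, rfl⟩)
      (Set.eq_univ_of_forall fun p => or_iff_not_imp_left.2 fun hp => ?_)
      (Set.ext fun x => (hU x).trans (or_iff_right (Set.notMem_empty _)).symm)
    obtain ⟨x, hx⟩ := (hY _).2 p.1.2
    have hp : p.2 = 0 := not_not.1 fun h => hp (Or.inr h)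
    exact ⟨⟨x, by simp [T, hx]⟩, by ext <;> simp [j, hx, hp]⟩
  exact (excision.trans (isHomologyShift_prodUnion_compl_zero isOpen_empty) (add_zero _)).trans
    (isHomologyShift_zero_empty W) (zero_add _)

end TubularNeighbourhood

end SingularCochain

/-! ### Hyperplane arrangements -/

namespace QuaternionicArrangement

open CategoryTheory Opposite SingularCochain

section Topology

variable {V : Type u} [AddCommGroup V] [Module ℍ[ℝ] V] [TopologicalSpace V]
  [ContinuousSMul ℍ[ℝ] V]

theorem continuous_real_smul : Continuous fun p : ℝ × V => (p.1 : ℍ[ℝ]) • p.2 :=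
  (Quaternion.continuous_coe.comp continuous_fst).smul continuous_snd

theorem cochainFunctor_exactAt_module (n : ℕ) :
    (cochainFunctor.obj (op (TopCat.of V))).ExactAt (n + 1) := by
  let toPoint : TopCat.of V ⟶ TopCat.of PUnit.{u + 1} := TopCat.ofHom (.const V PUnit.unit)
  let origin : TopCat.of PUnit.{u + 1} ⟶ TopCat.of V := TopCat.ofHom (.const PUnit 0)
  let contraction : TopCat.Homotopy (toPoint ≫ origin) (𝟙 (TopCat.of V)) :=
    ⟨⟨fun p => ((p.1 : ℝ) : ℍ[ℝ]) • (p.2 : V),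
      continuous_real_smul.comp (continuous_subtype_val.prodMap continuous_id)⟩,
      fun v => by simp [toPoint, origin], fun v => by simp⟩
  have := quasiIso_map_of_homotopyEquiv toPoint origin contraction (.refl (𝟙 _))
  exact (quasiIsoAt_iff_exactAt (cochainFunctor.map toPoint.op) (n + 1)
    (cochainFunctor_exactAt_of_totallyDisconnectedSpace _ n)).1 inferInstance

variable [IsTopologicalAddGroup V]

theorem continuous_of_finite [Module.Finite ℍ[ℝ] V] [T2Space V] (a : V →ₗ[ℍ[ℝ]] ℍ[ℝ]) :
    Continuous a := by
  let _ : Module ℝ V := Module.compHom V (algebraMap ℝ ℍ[ℝ])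
  have : IsScalarTower ℝ ℍ[ℝ] V := ⟨fun r q v => by
    rw [Algebra.smul_def, mul_smul]
    rfl⟩
  have : Module.Finite ℝ V := .trans ℍ[ℝ] V
  have : ContinuousSMul ℝ V := ⟨continuous_real_smul⟩
  exact (a.restrictScalars ℝ).continuous_of_finiteDimensional

theorem continuous_of_isClosed_ker {a : V →ₗ[ℍ[ℝ]] ℍ[ℝ]} [IsClosed (a.ker : Set V)] :
    Continuous a :=
  have : Module.Finite ℍ[ℝ] (V ⧸ a.ker) := Submodule.CoFG.ker a
  (continuous_of_finite (a.ker.liftQ a le_rfl)).comp continuous_quot_mk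

end Topology

namespace IsHyperplane

variable {V : Type u} [AddCommGroup V] [Module ℍ[ℝ] V] {A : Submodule ℍ[ℝ] V}

theorem cofg (hA : IsHyperplane A) : A.CoFG := by
  obtain ⟨a, -, rfl⟩ := hA
  exact .ker a

theorem ne_top (hA : IsHyperplane A) : A ≠ ⊤ := by
  obtain ⟨a, ha, rfl⟩ := hA
  exact LinearMap.ker_eq_top.not.2 ha

variable [TopologicalSpace V] [IsTopologicalAddGroup V] [ContinuousSMul ℍ[ℝ] V]

theorem isClosed [Module.Finite ℍ[ℝ] V] [T2Space V] (hA : IsHyperplane A) :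
    IsClosed (A : Set V) := by
  obtain ⟨a, -, rfl⟩ := hA
  exact isClosed_singleton.preimage (continuous_of_finite a)

theorem exists_homeomorph (hA : IsHyperplane A) (hAc : IsClosed (A : Set V)) :
    ∃ e : V ≃ₜ A × ℍ[ℝ], ∀ v : A, e v = (v, 0) := by
  obtain ⟨a, ha, rfl⟩ := hA
  obtain ⟨v₀, hv₀⟩ := LinearMap.surjective ha 1
  let f : V →L[ℍ[ℝ]] ℍ[ℝ] := ⟨a, continuous_of_isClosed_ker⟩
  let e := ContinuousLinearEquiv.equivOfRightInverse f (.toSpanSingleton ℍ[ℝ] v₀)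
    fun q => by simp [f, hv₀]
  refine ⟨e.toHomeomorph.trans (Homeomorph.prodComm _ _), fun v => ?_⟩
  have hv : f v = 0 := v.2
  ext <;> simp [e, hv]

end IsHyperplane

namespace Arrangement

variable {V : Type u} [AddCommGroup V] [Module ℍ[ℝ] V] (𝒜 : Arrangement V)
  {A : Submodule ℍ[ℝ] V}

theorem mem_complement {v : V} : v ∈ 𝒜.complement ↔ ∀ B ∈ 𝒜.hyperplanes, v ∉ B := by
  simp [complement]

theorem mem_complement_iff_deletion (hA : A ∈ 𝒜.hyperplanes) {v : V} :
    v ∈ 𝒜.complement ↔ v ∈ (𝒜.deletion A).complement ∧ v ∉ A := by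
  rw [mem_complement, mem_complement]
  refine ⟨fun h => ⟨fun B hB => h B hB.1, h A hA⟩, fun h B hB => ?_⟩
  obtain rfl | hBA := eq_or_ne B A
  exacts [h.2, h.1 B ⟨hB, hBA⟩]

theorem mem_complement_restriction (hA : A ∈ 𝒜.hyperplanes) {v : A} :
    v ∈ (𝒜.restriction A hA).complement ↔ (v : V) ∈ (𝒜.deletion A).complement := by
  rw [mem_complement, mem_complement]
  exact Set.forall_mem_image

section Rank

/-- The rank of an arrangement: the codimension of the intersection of all its hyperplanes. It is
at most the dimension of `V`, and finite even if `V` is not. -/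
def rank : ℕ := Module.finrank ℍ[ℝ] (V ⧸ sInf 𝒜.hyperplanes)

theorem cofg_sInf : (sInf 𝒜.hyperplanes).CoFG :=
  .sInf_of_finite 𝒜.finite fun A hA => (𝒜.isHyperplane A hA).cofg

theorem rank_le_finrank [Module.Finite ℍ[ℝ] V] : 𝒜.rank ≤ Module.finrank ℍ[ℝ] V :=
  Submodule.finrank_quotient_le _

theorem rank_deletion_le : (𝒜.deletion A).rank ≤ 𝒜.rank :=
  have := 𝒜.cofg_sInf
  LinearMap.finrank_le_finrank_of_surjective
    (Submodule.factor_surjective (sInf_le_sInf Set.sdiff_subset))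

theorem sInf_restriction (hA : A ∈ 𝒜.hyperplanes) :
    sInf (𝒜.restriction A hA).hyperplanes = (sInf 𝒜.hyperplanes).comap A.subtype := by
  ext v
  simp only [Submodule.mem_sInf, Submodule.mem_comap]
  refine Set.forall_mem_image.trans ⟨fun h B hB => ?_, fun h B hB => h B hB.1⟩
  obtain rfl | hBA := eq_or_ne B A
  exacts [v.2, h ⟨hB, hBA⟩]

theorem rank_restriction_lt (hA : A ∈ 𝒜.hyperplanes) : (𝒜.restriction A hA).rank < 𝒜.rank := by
  have := 𝒜.cofg_sInf
  let φ : A →ₗ[ℍ[ℝ]] V ⧸ sInf 𝒜.hyperplanes := (sInf 𝒜.hyperplanes).mkQ ∘ₗ A.subtype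
  have hker : φ.ker = sInf (𝒜.restriction A hA).hyperplanes := by
    rw [LinearMap.ker_comp, Submodule.ker_mkQ, sInf_restriction]
  have hrange : φ.range ≠ ⊤ := fun h => (𝒜.isHyperplane A hA).ne_top <| by
    rw [LinearMap.range_comp, Submodule.range_subtype] at h
    rw [← sup_eq_right.2 (sInf_le hA), ← Submodule.comap_map_mkQ, h, Submodule.comap_top]
  rw [rank, ← hker, φ.quotKerEquivRange.finrank_eq]
  exact Submodule.finrank_lt hrange

end Rank

section Tube

variable [TopologicalSpace V] {𝒜}

theorem mem_range_inclusion (hA : A ∈ 𝒜.hyperplanes) {x : (𝒜.deletion A).space} :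
    x ∈ Set.range (𝒜.inclusion A) ↔ x.1 ∉ A := by
  refine ⟨?_, fun hx => ⟨⟨x.1, (𝒜.mem_complement_iff_deletion hA).2 ⟨x.2, hx⟩⟩, rfl⟩⟩
  rintro ⟨y, rfl⟩
  exact ((𝒜.mem_complement_iff_deletion hA).1 y.2).2

theorem isHomologyShift_relCochain [IsTopologicalAddGroup V] [ContinuousSMul ℍ[ℝ] V]
    (hc : ∀ B ∈ 𝒜.hyperplanes, IsClosed (B : Set V)) (hA : A ∈ 𝒜.hyperplanes) :
    IsHomologyShift 4 (relCochain (𝒜.deletion A).space {Set.range (𝒜.inclusion A)})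
      (cochainFunctor.obj (op (𝒜.restriction A hA).space)) := by
  obtain ⟨e, he⟩ := (𝒜.isHyperplane A hA).exists_homeomorph (hc A hA)
  have mem_iff (v : V) : v ∈ A ↔ (e v).2 = 0 := by
    refine ⟨fun hv => congrArg Prod.snd (he ⟨v, hv⟩), fun h => ?_⟩
    have : e v = e ((e v).1 : A) := by rw [he, ← h]
    exact e.injective this ▸ (e v).1.2
  have range_iff (v : A) : (v, 0) ∈ Set.range (fun x : (𝒜.deletion A).complement => e x) ↔
      v ∈ (𝒜.restriction A hA).complement := by
    rw [mem_complement_restriction, ← he, Set.range_comp' e, e.injective.mem_set_image,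
      Subtype.range_coe]
  have hopen : IsOpen (𝒜.deletion A).complement :=
    ((𝒜.deletion A).finite.isClosed_biUnion fun B hB => hc B hB.1).isOpen_compl
  rw [← Quaternion.finrank_eq_four (R := ℝ)]
  exact isHomologyShift_finrank_of_isOpenEmbedding
    (e.isOpenEmbedding.comp hopen.isOpenEmbedding_subtypeVal) range_iff
    fun x => (mem_range_inclusion hA).trans (mem_iff x.1).not

end Tube

end Arrangement

open Limits

theorem isZero_singularCohomology_of_neg {i : ℤ} (hi : i < 0) (X : TopCat.{u}) :
    IsZero ((singularCohomology i).obj (op X)) := by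
  obtain ⟨n, rfl⟩ := Int.eq_negSucc_of_lt_zero hi
  exact AddCommGrpCat.isZero_of_subsingleton (AddCommGrpCat.of PUnit)

theorem nonempty_homology_iso_singularCohomology {k : ℕ} {X : TopCat.{u}}
    {K : HomologicalComplex AddCommGrpCat.{u} (ComplexShape.down ℕ).symm}
    (h : IsHomologyShift k K (cochainFunctor.obj (op X))) (m : ℕ) :
    Nonempty (K.homology m ≅ (singularCohomology ((m : ℤ) - k)).obj (op X)) := by
  obtain hmk | hkm := lt_or_ge m k
  · exact ⟨(h.1 m hmk).iso (isZero_singularCohomology_of_neg (by lia) X)⟩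
  · obtain ⟨n, rfl⟩ := Nat.exists_eq_add_of_le' hkm
    rw [show ((n + k : ℕ) : ℤ) - k = n by lia]
    exact h.2 n _ rfl

theorem exists_shortExact_of_iso {C : Type*} [Category* C] [Preadditive C] {S : ShortComplex C}
    (hS : S.ShortExact) {X₁ X₂ X₃ : C} (e₁ : S.X₁ ≅ X₁) (e₂ : S.X₂ ≅ X₂) (e₃ : S.X₃ ≅ X₃)
    (f : X₁ ⟶ X₂) (h : e₁.hom ≫ f = S.f ≫ e₂.hom) :
    ∃ (σ : X₂ ⟶ X₃) (w : f ≫ σ = 0), (ShortComplex.mk f σ w).ShortExact := by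
  have hw : f ≫ e₂.inv ≫ S.g ≫ e₃.hom = 0 := by
    rw [← cancel_epi e₁.hom, ← Category.assoc, h]
    simp
  exact ⟨_, hw, ShortComplex.shortExact_of_iso (ShortComplex.isoMk e₁ e₂ e₃ h (by simp)) hS⟩

theorem exists_shortExact_singularCohomology {X Y Z : TopCat.{u}} {k : ℕ} {j : Y ⟶ X}
    (hj : Topology.IsEmbedding j)
    (h : IsHomologyShift (k + 1) (relCochain X {Set.range j}) (cochainFunctor.obj (op Z)))
    (hzero : ∀ n : ℕ, IsZero ((singularCohomology (n : ℤ)).obj (op X)) ∨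
      IsZero ((singularCohomology (n - (k + 1 : ℕ) : ℤ)).obj (op Z))) (n : ℕ) :
    ∃ (σ : (singularCohomology n).obj (op Y) ⟶ (singularCohomology ((n : ℤ) - k)).obj (op Z))
      (w : (singularCohomology n).map j.op ≫ σ = 0),
      (ShortComplex.mk ((singularCohomology n).map j.op) σ w).ShortExact := by
  let absIso (X : TopCat.{u}) (n : ℕ) :
      (relCochain X ∅).homology n ≅ (singularCohomology n).obj (op X) :=
    (HomologicalComplex.homologyFunctor _ _ n).mapIso (relCochainEmptyIso X)
  have hmap (m : ℕ) : HomologicalComplex.homologyMap (pairSequence j rfl).f m = 0 := by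
    obtain hX | hZ := hzero m
    · exact (hX.of_iso (absIso X m)).eq_of_tgt _ _
    · exact (hZ.of_iso (nonempty_homology_iso_singularCohomology h m).some).eq_of_src _ _
  have hS := LongExactSequence.shortExact_homologyMap_g_δ (pairSequence_shortExact j hj rfl)
    (i := n) rfl (hmap n) (hmap (n + 1))
  obtain ⟨relIso⟩ := nonempty_homology_iso_singularCohomology h (n + 1)
  rw [show ((n + 1 : ℕ) : ℤ) - (k + 1 : ℕ) = n - k by lia] at relIso
  refine exists_shortExact_of_iso hS (absIso X n) (absIso Y n) relIso _ ?_
  exact (HomologicalComplex.homologyMap_comp _ _ n).symm.trans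
    ((congrArg (HomologicalComplex.homologyMap · n) (relCochainEmptyIso_naturality j).symm).trans
      (HomologicalComplex.homologyMap_comp _ _ n))

namespace Arrangement

variable {V : Type u} [AddCommGroup V] [Module ℍ[ℝ] V] [TopologicalSpace V] {𝒜 : Arrangement V}
  {A : Submodule ℍ[ℝ] V}

theorem isEmbedding_inclusion : Topology.IsEmbedding (𝒜.inclusion A) :=
  Topology.IsEmbedding.inclusion (𝒜.complement_subset_deletion A)

theorem isClosed_of_mem_restriction (hc : ∀ B ∈ 𝒜.hyperplanes, IsClosed (B : Set V))
    (hA : A ∈ 𝒜.hyperplanes) :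
    ∀ B ∈ (𝒜.restriction A hA).hyperplanes, IsClosed (B : Set A) :=
  Set.forall_mem_image.2 fun B hB => (hc B hB.1).preimage continuous_subtype_val

variable [ContinuousSMul ℍ[ℝ] V]

theorem isZero_singularCohomology_of_hyperplanes_eq_empty (h : 𝒜.hyperplanes = ∅) {i : ℤ}
    (hi : i ≠ 0) : IsZero ((singularCohomology i).obj (op 𝒜.space)) := by
  obtain hneg | hpos := hi.lt_or_gt
  · exact isZero_singularCohomology_of_neg hneg _
  obtain ⟨n, rfl⟩ : ∃ n : ℕ, i = (n + 1 : ℕ) := ⟨(i - 1).toNat, by lia⟩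
  have huniv : 𝒜.complement = Set.univ := by simp [complement, h]
  let e : 𝒜.space ≅ TopCat.of V :=
    TopCat.isoOfHomeo ((Homeomorph.setCongr huniv).trans (Homeomorph.Set.univ V))
  exact (cochainFunctor_exactAt_module n).isZero_homology.of_iso
    ((singularCohomologyNat (n + 1)).mapIso e.op).symm

variable [IsTopologicalAddGroup V]

theorem exists_shortExact (hc : ∀ B ∈ 𝒜.hyperplanes, IsClosed (B : Set V))
    (hA : A ∈ 𝒜.hyperplanes)
    (h' : ∀ i : ℤ, ¬ 3 ∣ i → IsZero ((singularCohomology i).obj (op (𝒜.deletion A).space)))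
    (h'' : ∀ i : ℤ, ¬ 3 ∣ i → IsZero ((singularCohomology i).obj (op (𝒜.restriction A hA).space)))
    (i : ℤ) :
    ∃ (σ : (singularCohomology i).obj (op 𝒜.space) ⟶
        (singularCohomology (i - 3)).obj (op (𝒜.restriction A hA).space))
      (w : (singularCohomology i).map (𝒜.inclusion A).op ≫ σ = 0),
      (ShortComplex.mk ((singularCohomology i).map (𝒜.inclusion A).op) σ w).ShortExact := by
  obtain hi | hi := lt_or_ge i 0
  · have (X : TopCat.{u}) := isZero_singularCohomology_of_neg hi X
    have hi3 := isZero_singularCohomology_of_neg (i := i - 3) (by lia) (𝒜.restriction A hA).space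
    exact ⟨0, comp_zero, .mk' (ShortComplex.exact_of_isZero_X₂ _ (this _))
      ⟨fun _ _ _ => (this _).eq_of_tgt _ _⟩ ⟨fun _ _ _ => hi3.eq_of_src _ _⟩⟩
  · lift i to ℕ using hi
    refine exists_shortExact_singularCohomology isEmbedding_inclusion
      (isHomologyShift_relCochain hc hA) (fun n => ?_) i
    by_cases hn : (3 : ℤ) ∣ n
    · exact Or.inr (h'' _ (by lia))
    · exact Or.inl (h' n hn)

theorem isZero_singularCohomology (hc : ∀ B ∈ 𝒜.hyperplanes, IsClosed (B : Set V)) {i : ℤ}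
    (hi : ¬ 3 ∣ i ∨ i < 0 ∨ 3 * (𝒜.rank : ℤ) < i) :
    IsZero ((singularCohomology i).obj (op 𝒜.space)) := by
  induction hn : 𝒜.hyperplanes.ncard using Nat.strong_induction_on generalizing V i with
  | _ n ih =>
  obtain h | ⟨A, hA⟩ := 𝒜.hyperplanes.eq_empty_or_nonempty
  · exact isZero_singularCohomology_of_hyperplanes_eq_empty h (by lia)
  have hdel : (𝒜.deletion A).hyperplanes.ncard < n :=
    hn ▸ Set.ncard_sdiff_singleton_lt_of_mem hA 𝒜.finite
  have hres : (𝒜.restriction A hA).hyperplanes.ncard < n :=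
    (Set.ncard_image_le (𝒜.deletion A).finite).trans_lt hdel
  have hc' : ∀ B ∈ (𝒜.deletion A).hyperplanes, IsClosed (B : Set V) := fun B hB => hc B hB.1
  have vanish' {i : ℤ} (hi : _) := ih _ hdel hc' (i := i) hi rfl
  have vanish'' {i : ℤ} (hi : _) := ih _ hres (isClosed_of_mem_restriction hc hA) (i := i) hi rfl
  obtain ⟨σ, w, hσ⟩ := exists_shortExact hc hA (fun i hi => vanish' (.inl hi))
    (fun i hi => vanish'' (.inl hi)) i
  have hrank' := 𝒜.rank_deletion_le (A := A)
  have hrank'' := 𝒜.rank_restriction_lt hA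
  exact hσ.exact.isZero_X₂ ((vanish' (by lia)).eq_of_src _ _) ((vanish'' (by lia)).eq_of_tgt _ _)

end Arrangement

end QuaternionicArrangement

end

open QuaternionicArrangement CategoryTheory Opposite in
theorem mainTheorem3_general {V : Type u} [AddCommGroup V] [Module ℍ[ℝ] V] [TopologicalSpace V]
    [IsTopologicalAddGroup V] [ContinuousSMul ℍ[ℝ] V] (𝒜 : Arrangement V)
    (hc : ∀ A ∈ 𝒜.hyperplanes, IsClosed (A : Set V)) :
    (∀ (A : Submodule ℍ[ℝ] V) (hA : A ∈ 𝒜.hyperplanes) (i : ℤ),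
      ∃ (σ : (singularCohomology i).obj (op 𝒜.space) ⟶
          (singularCohomology (i - 3)).obj (op (𝒜.restriction A hA).space))
        (w : (singularCohomology i).map (𝒜.inclusion A).op ≫ σ = 0),
        (ShortComplex.mk ((singularCohomology i).map (𝒜.inclusion A).op) σ w).ShortExact) ∧
    (∀ i : ℤ, (¬ (3 ∣ i) ∨ i < 0 ∨ 3 * (𝒜.rank : ℤ) < i) →
      Limits.IsZero ((singularCohomology i).obj (op 𝒜.space))) := by
  refine ⟨fun A hA => Arrangement.exists_shortExact hc hA (fun i hi => ?_) (fun i hi => ?_),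
    fun i => Arrangement.isZero_singularCohomology hc⟩
  · exact Arrangement.isZero_singularCohomology (𝒜 := 𝒜.deletion A) (fun B hB => hc B hB.1)
      (.inl hi)
  · exact Arrangement.isZero_singularCohomology
      (Arrangement.isClosed_of_mem_restriction hc hA) (.inl hi)

theorem mainTheorem3 {V : Type u} [AddCommGroup V] [Module ℍ[ℝ] V] [Module.Finite ℍ[ℝ] V]
    [TopologicalSpace V] [T2Space V] [IsTopologicalAddGroup V] [ContinuousSMul ℍ[ℝ] V]
    (𝒜 : QuaternionicArrangement.Arrangement V) :
    (∀ (A : Submodule ℍ[ℝ] V) (hA : A ∈ 𝒜.hyperplanes) (i : ℤ),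
      ∃ (σ : (QuaternionicArrangement.singularCohomology i).obj (Opposite.op 𝒜.space) ⟶
          (QuaternionicArrangement.singularCohomology (i - 3)).obj
            (Opposite.op (𝒜.restriction A hA).space))
        (w : CategoryTheory.CategoryStruct.comp
          ((QuaternionicArrangement.singularCohomology i).map (𝒜.inclusion A).op) σ = 0),
        (CategoryTheory.ShortComplex.mk
          ((QuaternionicArrangement.singularCohomology i).map (𝒜.inclusion A).op)
          σ w).ShortExact) ∧
    (∀ i : ℤ, (¬ (3 ∣ i) ∨ i < 0 ∨ 3 * (Module.finrank ℍ[ℝ] V : ℤ) < i) →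
      CategoryTheory.Limits.IsZero
        ((QuaternionicArrangement.singularCohomology i).obj (Opposite.op 𝒜.space))) := by
  obtain ⟨shortExact, vanishing⟩ :=
    mainTheorem3_general 𝒜 fun A hA => (𝒜.isHyperplane A hA).isClosed
  have := 𝒜.rank_le_finrank
  exact ⟨shortExact, fun i hi => vanishing i (by lia)⟩
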